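/- Let $a<b$, $T>0$, $\delta>0$, $\nu>0$ and $k\ge 0$ be fixed. Let $\gamma:\mathbb R\to[0,\infty)$ be even, with $\gamma\in L^1_{\mathrm{loc}}(\mathbb R)$ and $0<\int_{-\delta}^{\delta}s^2\gamma(s)\,ds<\infty$. All functions of $x$ are extended $(b-a)$-periodically to $\mathbb R$. *Exact problem.* $(u,q)$ solves $$u_{tt}-2\int_0^\delta s^2\gamma(s)\,\tfrac1s\big(q(x,t;s)-q(x-s,t;s)\big)\,ds=0\ \text{ on }(a,b)\times(0,T),\qquad q(x,t;s)=\tfrac1s\big(u(x+s,t)-u(x,t)\big)\ \text{ for } s\in(0,\delta],\ t\in[0,T],$$ and is periodic in $x$. *Scheme.* For a partition $a=x_{1/2}<\dots<x_{N+1/2}=b$ into cells $I_j=(x_{j-1/2},x_{j+1/2})$ of lengths $h_j$, let $h=\max_jh_j$ and assume $\nu h\le\min_jh_j$. Let $V_h^k$ be the space of functions that are polynomials of degree at most $k$ on each $I_j$. A semi-discrete DG solution is a pair with $u_h(\cdot,t)\in V_h^k$ and $q_h(\cdot,t;s)\in V_h^k$ for $t\in[0,T]$, $s\in(0,\delta]$,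 where $u_h$ is $C^2$ in $t$, such that for all $v_h,w_h\in V_h^k$ and all $j$ $$\int_{I_j}(u_h)_{tt}v_h\,dx-2\int_0^\delta s^2\gamma(s)\int_{I_j}\tfrac1s\big(q_h(x,t;s)-q_h(x-s,t;s)\big)v_h(x)\,dx\,ds=0\quad(0<t<T),$$ $$\int_{I_j}q_h(x,t;s)w_h\,dx-\int_{I_j}\tfrac1s\big(u_h(x+s,t)-u_h(x,t)\big)w_h(x)\,dx=0\quad(0\le t\le T,\ 0<s\le\delta).$$ The initial data are $u_h(\cdot,0)=P_hu(\cdot,0)$ and $(u_h)_t(\cdot,0)=P_hu_t(\cdot,0)$, where $P_h$ is the $L^2$-projection onto $V_h^k$. Put $e_u=u_h-u$ and $e_q=q_h-q$. **Theorem.** For every $M$ there is a constant $C>0$, depending only on $a,b,T,\nu,k,\gamma,\delta$ and $M$ (in particular not on $h$ or on the partition), such that the following holds. If $u\in C^{k+2}(\mathbb R\times[0,T])$, $|u_t(\cdot,t)|_{H^{k+1}(a,b)}\le M$ for all $t\in[0,T]$ and $|q(\cdot,t;s)|_{H^{k+1}(a,b)}\le M$ for all $t\in[0,T]$ and $s\in(0,\delta]$,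 then for every such partition and every DG solution $(u_h,q_h)$ with these initial data, the function $s\mapsto s^2\gamma(s)\|e_q(\cdot,t;s)\|^2_{L^2(a,b)}$ is integrable on $(0,\delta]$ and $$\tfrac12\|(e_u)_t(\cdot,t)\|_{L^2(a,b)}^2+\int_0^\delta s^2\gamma(s)\,\|e_q(\cdot,t;s)\|_{L^2(a,b)}^2\,ds\le C\,h^{2k+2}\qquad\text{for all }t\in[0,T].$$ -/

import Mathlib

noncomputable section

namespace NonlocalDG

/-- The time derivative on `[0, T]` (one-sided at the two end points) of `f = f(x, t)`. -/
def dt (T : ℝ) (f : ℝ → ℝ → ℝ) (x t : ℝ) : ℝ :=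
  derivWithin (fun τ => f x τ) (Set.Icc 0 T) t

/-- The norm of `L²(a, b)`. -/
def l2Norm (a b : ℝ) (v : ℝ → ℝ) : ℝ :=
  Real.sqrt (∫ x in a..b, (v x) ^ 2)

/-- The seminorm `|v|` of `H^m(a, b)`, for functions `v` of class `C^m`. -/
def hSeminorm (a b : ℝ) (m : ℕ) (v : ℝ → ℝ) : ℝ :=
  l2Norm a b (iteratedDeriv m v)

/-- The radial kernel `γ(x, y) = γ(x - y)` is nonnegative and symmetric, and
`0 < ∫_{-δ}^{δ} s² γ(s) ds < ∞`. -/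
structure KernelCondition (δ : ℝ) (γ : ℝ → ℝ) : Prop where
  nonneg : ∀ s, 0 ≤ γ s
  even : ∀ s, γ (-s) = γ s
  integrable : IntervalIntegrable (fun s => s ^ 2 * γ s) MeasureTheory.volume (-δ) δ
  pos : 0 < ∫ s in (-δ)..δ, s ^ 2 * γ s

/-- `(u, q)` solves the first order reformulation of the nonlocal wave equation on
`(a, b) × (0, T)`, with periodic boundary conditions: the functions of `x` are the
`(b - a)`-periodic ones. -/
structure IsExactSolution (a b T δ : ℝ) (γ : ℝ → ℝ)
    (u : ℝ → ℝ → ℝ) (q : ℝ → ℝ → ℝ → ℝ) : Prop where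
  periodic : ∀ t ∈ Set.Icc 0 T, Function.Periodic (fun x => u x t) (b - a)
  wave : ∀ t ∈ Set.Ioo 0 T, ∀ x ∈ Set.Ioo a b,
    dt T (dt T u) x t
      - 2 * ∫ s in (0 : ℝ)..δ, s ^ 2 * γ s * (1 / s * (q x t s - q (x - s) t s)) = 0
  aux : ∀ t ∈ Set.Icc 0 T, ∀ s ∈ Set.Ioc 0 δ, ∀ x,
    q x t s - 1 / s * (u (x + s) t - u x t) = 0

/-- A partition `a = x_{1/2} < x_{3/2} < ⋯ < x_{N+1/2} = b`. -/
structure Mesh (a b : ℝ) where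
  N : ℕ
  node : Fin (N + 1) → ℝ
  strictMono : StrictMono node
  node_first : node 0 = a
  node_last : node (Fin.last N) = b

namespace Mesh

variable {a b : ℝ}

/-- The left end point of the `j`-th cell. -/
def left (m : Mesh a b) (j : Fin m.N) : ℝ := m.node j.castSucc

/-- The right end point of the `j`-th cell. -/
def right (m : Mesh a b) (j : Fin m.N) : ℝ := m.node j.succ

/-- The `j`-th cell `I_j`. -/
def cell (m : Mesh a b) (j : Fin m.N) : Set ℝ := Set.Ioo (m.left j) (m.right j)

/-- The length `h_j` of the `j`-th cell. -/
def length (m : Mesh a b) (j : Fin m.N) : ℝ := m.right j - m.left j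

/-- The mesh size `h = max_j h_j` (a supremum over a finite set, nonempty when `a < b`). -/
def size (m : Mesh a b) : ℝ := ⨆ j, m.length j

/-- The regularity condition `ν max_j h_j ≤ min_j h_j`. -/
def IsRegular (m : Mesh a b) (ν : ℝ) : Prop := ∀ j, ν * m.size ≤ m.length j

/-- The space `V_h^k` of functions that agree with a polynomial of degree at most `k` on each
(open) cell, extended periodically; the values at the nodes are immaterial. -/
def dgSpace (m : Mesh a b) (k : ℕ) : Set (ℝ → ℝ) :=
  {v | Function.Periodic v (b - a) ∧
    ∀ j, ∃ p : Polynomial ℝ, p.natDegree ≤ k ∧ ∀ x ∈ m.cell j, v x = p.eval x}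

/-- `ℋ_j(v, w; s)`. -/
def opH (m : Mesh a b) (j : Fin m.N) (v w : ℝ → ℝ) (s : ℝ) : ℝ :=
  ∫ x in (m.left j)..(m.right j), 1 / s * (v (x + s) - v x) * w x

/-- `𝒦_j(v, w; s)`. -/
def opK (m : Mesh a b) (j : Fin m.N) (v w : ℝ → ℝ) (s : ℝ) : ℝ :=
  ∫ x in (m.left j)..(m.right j), 1 / s * (v x - v (x - s)) * w x

/-- `w = P_h v`, the `L²` projection of `v` onto `V_h^k`. -/
def IsL2Projection (m : Mesh a b) (k : ℕ) (v w : ℝ → ℝ) : Prop :=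
  w ∈ m.dgSpace k ∧ ∀ j, ∀ p : Polynomial ℝ, p.natDegree ≤ k →
    ∫ x in (m.left j)..(m.right j), (v x - w x) * p.eval x = 0

/-- `(uh, qh)` is a solution on `[0, T]` of the semi-discrete scheme. -/
structure IsDGSolution (m : Mesh a b) (T δ : ℝ) (k : ℕ) (γ : ℝ → ℝ)
    (uh : ℝ → ℝ → ℝ) (qh : ℝ → ℝ → ℝ → ℝ) : Prop where
  mem_u : ∀ t ∈ Set.Icc 0 T, (fun x => uh x t) ∈ m.dgSpace k
  mem_q : ∀ t ∈ Set.Icc 0 T, ∀ s ∈ Set.Ioc 0 δ, (fun x => qh x t s) ∈ m.dgSpace k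
  time_smooth : ∀ j, ∀ x ∈ m.cell j, ContDiffOn ℝ 2 (fun t => uh x t) (Set.Icc 0 T)
  wave : ∀ t ∈ Set.Ioo 0 T, ∀ j, ∀ v ∈ m.dgSpace k,
    (∫ x in (m.left j)..(m.right j), dt T (dt T uh) x t * v x)
      - 2 * ∫ s in (0 : ℝ)..δ, s ^ 2 * γ s * m.opK j (fun x => qh x t s) v s = 0
  aux : ∀ t ∈ Set.Icc 0 T, ∀ s ∈ Set.Ioc 0 δ, ∀ j, ∀ w ∈ m.dgSpace k,
    (∫ x in (m.left j)..(m.right j), qh x t s * w x) - m.opH j (fun x => uh x t) w s = 0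

/-- The initial data of the scheme are the `L²` projections of those of the exact solution. -/
def HasProjectedInitialData (m : Mesh a b) (T : ℝ) (k : ℕ) (u uh : ℝ → ℝ → ℝ) : Prop :=
  m.IsL2Projection k (fun x => u x 0) (fun x => uh x 0) ∧
    ∀ j, ∀ p : Polynomial ℝ, p.natDegree ≤ k →
      ∫ x in (m.left j)..(m.right j), (dt T u x 0 - dt T uh x 0) * p.eval x = 0

end Mesh

end NonlocalDG

end

/-! Since `γ` is integrable on `(0, δ]`, the nonlocal operator is bounded on `L²(a, b)` by a
multiple of `G = ∫₀^δ |γ|`, the factors `1 / s` of its two difference quotients being absorbed by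
`s²`. No energy argument is needed: let `c` be the vector of coefficients of `e_u` in an
`L²`-orthonormal basis of `V_h^k`. Testing both wave equations with `V_h^k` and comparing `q_h` with
the difference quotient of `u_h`, of which it is the `L²` projection, gives
`‖c''‖ ≤ 8 G ‖c‖ + O(h^{k+1})`, and `c(0) = c'(0) = 0` by the choice of the initial data, so that
`c` and `c'` are `O(h^{k+1})` by Grönwall's inequality. Bessel's inequality and the approximation
property of `V_h^k` recover `(e_u)_t` and `e_q` from `c'` and `c`. The bound on `|u|_{H^{k+1}}`
which this takes comes from the one on `q(·, t; s)`, which gives `|u|_{H^{k+2}} ≤ M` as `s → 0`, and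
from Poincaré's inequality for the derivative of a periodic function. -/

namespace NonlocalDG

open MeasureTheory Set Filter Topology

section EssentiallyBounded

variable {f g : ℝ → ℝ}

theorem intervalIntegrable_of_memLp_top (hf : MemLp f ⊤ volume) (a b : ℝ) :
    IntervalIntegrable f volume a b :=
  ⟨(hf.restrict _).integrable le_top, (hf.restrict _).integrable le_top⟩

theorem memLp_top_mul (hf : MemLp f ⊤ volume) (hg : MemLp g ⊤ volume) :
    MemLp (fun x => f x * g x) ⊤ volume :=
  hg.mul' hf

theorem memLp_top_comp_add (hf : MemLp f ⊤ volume) (s : ℝ) :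
    MemLp (fun x => f (x + s)) ⊤ volume :=
  hf.comp_measurePreserving (measurePreserving_add_right volume s)

theorem memLp_top_of_continuous_periodic {L : ℝ} (hL : 0 < L) (hf : Continuous f)
    (hp : Function.Periodic f L) : MemLp f ⊤ volume := by
  obtain ⟨C, hC⟩ := isCompact_Icc.exists_bound_of_continuousOn
    (s := Icc 0 L) hf.continuousOn
  refine memLp_top_of_bound hf.aestronglyMeasurable C (.of_forall fun x => ?_)
  obtain ⟨y, hy, hxy⟩ := hp.exists_mem_Ico₀ hL x
  rw [hxy]
  exact hC y (Ico_subset_Icc_self hy)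

theorem memLp_two_Ioc_of_memLp_top (hf : MemLp f ⊤ volume) (a b : ℝ) :
    MemLp f 2 (volume.restrict (Ioc a b)) :=
  (hf.restrict _).mono_exponent le_top

theorem memLp_two_Ioc_of_continuous (hf : Continuous f) (a b : ℝ) :
    MemLp f 2 (volume.restrict (Ioc a b)) := by
  obtain ⟨C, hC⟩ := (isCompact_Icc (a := a) (b := b)).exists_bound_of_continuousOn hf.continuousOn
  exact MemLp.of_bound hf.aestronglyMeasurable C
    ((ae_restrict_mem measurableSet_Ioc).mono fun x hx => hC x (Ioc_subset_Icc_self hx))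

end EssentiallyBounded

section L2Norm

variable {a b l r : ℝ} {f g : ℝ → ℝ}

theorem l2Norm_nonneg (a b : ℝ) (f : ℝ → ℝ) : 0 ≤ l2Norm a b f :=
  Real.sqrt_nonneg _

theorem l2Norm_sq (hab : a ≤ b) (f : ℝ → ℝ) : l2Norm a b f ^ 2 = ∫ x in a..b, f x ^ 2 :=
  Real.sq_sqrt (intervalIntegral.integral_nonneg hab fun _ _ => sq_nonneg _)

theorem l2Norm_neg (a b : ℝ) (f : ℝ → ℝ) : l2Norm a b (fun x => -f x) = l2Norm a b f := by
  simp only [l2Norm, neg_sq]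

theorem l2Norm_sub_comm (a b : ℝ) (f g : ℝ → ℝ) :
    l2Norm a b (fun x => f x - g x) = l2Norm a b (fun x => g x - f x) := by
  rw [← l2Norm_neg]
  simp only [neg_sub]

theorem l2Norm_const_mul (a b c : ℝ) (f : ℝ → ℝ) :
    l2Norm a b (fun x => c * f x) = |c| * l2Norm a b f := by
  simp only [l2Norm, mul_pow, intervalIntegral.integral_const_mul]
  rw [Real.sqrt_mul (sq_nonneg c), Real.sqrt_sq_eq_abs]

theorem inner_toLp_eq_integral (hab : a ≤ b) (hf : MemLp f 2 (volume.restrict (Ioc a b)))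
    (hg : MemLp g 2 (volume.restrict (Ioc a b))) :
    inner ℝ (hf.toLp f) (hg.toLp g) = ∫ x in a..b, f x * g x := by
  rw [L2.inner_def, intervalIntegral.integral_of_le hab]
  refine integral_congr_ae ?_
  filter_upwards [hf.coeFn_toLp, hg.coeFn_toLp] with x hx hy
  rw [hx, hy, real_inner_comm]
  rfl

theorem l2Norm_eq_norm_toLp (hab : a ≤ b) (hf : MemLp f 2 (volume.restrict (Ioc a b))) :
    l2Norm a b f = ‖hf.toLp f‖ := by
  rw [norm_eq_sqrt_real_inner, inner_toLp_eq_integral hab, l2Norm]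
  simp only [pow_two]

theorem abs_integral_mul_le (hab : a ≤ b) (hf : MemLp f 2 (volume.restrict (Ioc a b)))
    (hg : MemLp g 2 (volume.restrict (Ioc a b))) :
    |∫ x in a..b, f x * g x| ≤ l2Norm a b f * l2Norm a b g := by
  rw [← inner_toLp_eq_integral hab hf hg, l2Norm_eq_norm_toLp hab hf, l2Norm_eq_norm_toLp hab hg]
  exact abs_real_inner_le_norm _ _

theorem l2Norm_sub_le (hab : a ≤ b) (hf : MemLp f 2 (volume.restrict (Ioc a b)))
    (hg : MemLp g 2 (volume.restrict (Ioc a b))) :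
    l2Norm a b (fun x => f x - g x) ≤ l2Norm a b f + l2Norm a b g := by
  have h := l2Norm_eq_norm_toLp hab (hf.sub hg)
  rw [MemLp.toLp_sub hf hg] at h
  rw [l2Norm_eq_norm_toLp hab hf, l2Norm_eq_norm_toLp hab hg]
  exact h.trans_le (norm_sub_le _ _)

theorem l2Norm_sub_le_sub_add_sub {h : ℝ → ℝ} (hab : a ≤ b)
    (hf : MemLp f 2 (volume.restrict (Ioc a b))) (hg : MemLp g 2 (volume.restrict (Ioc a b)))
    (hh : MemLp h 2 (volume.restrict (Ioc a b))) :
    l2Norm a b (fun x => f x - h x)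
      ≤ l2Norm a b (fun x => f x - g x) + l2Norm a b (fun x => g x - h x) := by
  have key := l2Norm_sub_le hab (hf.sub hg) (hh.sub hg)
  rw [l2Norm_sub_comm a b g h]
  calc l2Norm a b (fun x => f x - h x)
      = l2Norm a b (fun x => (f x - g x) - (h x - g x)) := by simp only [sub_sub_sub_cancel_right]
    _ ≤ _ := key

theorem l2Norm_mono_interval (hf : IntervalIntegrable (fun x => f x ^ 2) volume a b) (hal : a ≤ l)
    (hlr : l ≤ r) (hrb : r ≤ b) : l2Norm l r f ≤ l2Norm a b f :=
  Real.sqrt_le_sqrt (intervalIntegral.integral_mono_interval hal hlr hrb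
    (.of_forall fun _ => sq_nonneg _) hf)

theorem integral_comp_add_of_periodic (hf : Function.Periodic f (b - a)) (s : ℝ) :
    ∫ x in a..b, f (x + s) = ∫ x in a..b, f x := by
  have h := hf.intervalIntegral_add_eq (a + s) a
  rwa [show a + s + (b - a) = b + s by ring, show a + (b - a) = b by ring,
    ← intervalIntegral.integral_comp_add_right] at h

theorem l2Norm_comp_add (hf : Function.Periodic f (b - a)) (s : ℝ) :
    l2Norm a b (fun x => f (x + s)) = l2Norm a b f := by
  have hf2 : Function.Periodic (fun x => f x ^ 2) (b - a) := fun x => by simp only [hf x]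
  rw [l2Norm, l2Norm, integral_comp_add_of_periodic hf2]

theorem l2Norm_period (hf : Function.Periodic f (b - a)) (c : ℝ) :
    l2Norm c (c + (b - a)) f = l2Norm a b f := by
  have hf2 : Function.Periodic (fun x => f x ^ 2) (b - a) := fun x => by simp only [hf x]
  rw [l2Norm, l2Norm, hf2.intervalIntegral_add_eq c a, add_sub_cancel]

end L2Norm

section DiffQuot

/-- The difference quotient `(f (x + s) - f x) / s`. For negative `s` this is the backward
quotient, so that the two discrete derivatives of the scheme are `diffQuot s` and
`diffQuot (-s)`. -/
noncomputable def diffQuot (s : ℝ) (f : ℝ → ℝ) (x : ℝ) : ℝ := 1 / s * (f (x + s) - f x)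

variable {a b s : ℝ} {f : ℝ → ℝ}

theorem diffQuot_neg (s : ℝ) (f : ℝ → ℝ) (x : ℝ) :
    diffQuot (-s) f x = 1 / s * (f x - f (x - s)) := by
  rw [diffQuot, ← sub_eq_add_neg, div_neg, neg_mul, ← mul_neg, neg_sub]

theorem diffQuot_sub (s : ℝ) (f g : ℝ → ℝ) (x : ℝ) :
    diffQuot s (fun y => f y - g y) x = diffQuot s f x - diffQuot s g x := by
  simp only [diffQuot]; ring

theorem diffQuot_periodic {L : ℝ} (hp : Function.Periodic f L) (s : ℝ) :
    Function.Periodic (diffQuot s f) L := fun x => by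
  rw [diffQuot, diffQuot, hp x, add_right_comm, hp (x + s)]

theorem memLp_top_diffQuot (hf : MemLp f ⊤ volume) (s : ℝ) : MemLp (diffQuot s f) ⊤ volume :=
  ((memLp_top_comp_add hf s).sub hf).const_mul (1 / s)

theorem diffQuot_congr_ae {g : ℝ → ℝ} (h : f =ᵐ[volume] g) (s : ℝ) :
    diffQuot s f =ᵐ[volume] diffQuot s g := by
  filter_upwards [h, (measurePreserving_add_right volume s).quasiMeasurePreserving.ae h]
    with x hx hxs
  rw [diffQuot, diffQuot, hx, hxs]

theorem l2Norm_diffQuot_le (hab : a ≤ b) (hf : MemLp f ⊤ volume)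
    (hp : Function.Periodic f (b - a)) :
    l2Norm a b (diffQuot s f) ≤ 2 / |s| * l2Norm a b f :=
  calc l2Norm a b (diffQuot s f)
      = |1 / s| * l2Norm a b (fun x => f (x + s) - f x) := l2Norm_const_mul a b _ _
    _ ≤ |1 / s| * (l2Norm a b (fun x => f (x + s)) + l2Norm a b f) := by
        gcongr
        exact l2Norm_sub_le hab (memLp_two_Ioc_of_memLp_top (memLp_top_comp_add hf s) a b)
          (memLp_two_Ioc_of_memLp_top hf a b)
    _ = 2 / |s| * l2Norm a b f := by
        rw [l2Norm_comp_add hp, abs_div, abs_one]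
        ring

end DiffQuot

section PolynomialApproximation

variable {l r : ℝ}

theorem abs_le_sqrt_mul_l2Norm_deriv {R : ℝ → ℝ} (hR : ContDiff ℝ 1 R) (h0 : R l = 0) {x : ℝ}
    (hx : x ∈ Icc l r) : |R x| ≤ √(r - l) * l2Norm l r (deriv R) := by
  have hR' : Continuous (deriv R) := hR.continuous_deriv_one
  have hFTC : R x = ∫ y in l..x, 1 * deriv R y := by
    simp only [one_mul]
    rw [intervalIntegral.integral_deriv_eq_sub (fun y _ => hR.differentiable one_ne_zero y)
      (hR'.intervalIntegrable _ _), h0, sub_zero]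
  have hone : l2Norm l x (fun _ => 1) = √(x - l) := by simp [l2Norm]
  calc |R x| ≤ l2Norm l x (fun _ => 1) * l2Norm l x (deriv R) := by
        rw [hFTC]
        exact abs_integral_mul_le hx.1 (memLp_two_Ioc_of_continuous continuous_const l x)
          (memLp_two_Ioc_of_continuous hR' l x)
    _ ≤ √(r - l) * l2Norm l r (deriv R) := by
        rw [hone]
        gcongr
        · exact l2Norm_nonneg _ _ _
        · exact hx.2
        · exact l2Norm_mono_interval ((hR'.pow 2).intervalIntegrable _ _) le_rfl hx.1 hx.2

theorem l2Norm_le_mul_l2Norm_deriv (hlr : l ≤ r) {R : ℝ → ℝ} (hR : ContDiff ℝ 1 R)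
    (h0 : R l = 0) : l2Norm l r R ≤ (r - l) * l2Norm l r (deriv R) := by
  have hlr' : 0 ≤ r - l := sub_nonneg.2 hlr
  refine Real.sqrt_le_iff.2 ⟨mul_nonneg hlr' (l2Norm_nonneg _ _ _), ?_⟩
  calc ∫ x in l..r, R x ^ 2
      ≤ ∫ _ in l..r, (√(r - l) * l2Norm l r (deriv R)) ^ 2 :=
        intervalIntegral.integral_mono_on hlr ((hR.continuous.pow 2).intervalIntegrable _ _)
          (by simp) fun x hx => sq_le_sq' (abs_le.1 (abs_le_sqrt_mul_l2Norm_deriv hR h0 hx)).1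
            (abs_le.1 (abs_le_sqrt_mul_l2Norm_deriv hR h0 hx)).2
    _ = ((r - l) * l2Norm l r (deriv R)) ^ 2 := by
        rw [intervalIntegral.integral_const, smul_eq_mul, mul_pow, Real.sq_sqrt hlr']
        ring

theorem mem_degreeLT_succ_iff {k : ℕ} {p : Polynomial ℝ} :
    p ∈ Polynomial.degreeLT ℝ (k + 1) ↔ p.natDegree ≤ k := by
  rw [Polynomial.degreeLT_succ_eq_degreeLE, Polynomial.mem_degreeLE,
    Polynomial.natDegree_le_iff_degree_le]

theorem exists_derivative_eq {n : ℕ} {p : Polynomial ℝ} (hp : p ∈ Polynomial.degreeLT ℝ n) :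
    ∃ P ∈ Polynomial.degreeLT ℝ (n + 1), P.derivative = p := by
  refine ⟨∑ i ∈ Finset.range n, Polynomial.monomial (i + 1) (p.coeff i / (i + 1)),
    Submodule.sum_mem _ fun i hi => ?_, ?_⟩
  · exact mem_degreeLT_succ_iff.2 ((Polynomial.natDegree_monomial_le _).trans
      (Finset.mem_range.1 hi))
  · ext i
    simp only [Polynomial.derivative_sum, Polynomial.derivative_monomial,
      Polynomial.finsetSum_coeff, Polynomial.coeff_monomial, Nat.add_sub_cancel,
      Finset.sum_ite_eq', Finset.mem_range]
    split_ifs with hi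
    · have : (i : ℝ) + 1 ≠ 0 := by positivity
      push_cast
      field_simp
    · exact (Polynomial.coeff_eq_zero_of_degree_lt ((Polynomial.mem_degreeLT.1 hp).trans_le
        (by exact_mod_cast not_lt.1 hi))).symm

theorem exists_polynomial_l2Norm_sub_le (hlr : l ≤ r) {n : ℕ} {v : ℝ → ℝ}
    (hv : ContDiff ℝ n v) : ∃ p ∈ Polynomial.degreeLT ℝ n,
      l2Norm l r (fun x => v x - p.eval x) ≤ (r - l) ^ n * hSeminorm l r n v := by
  induction n generalizing v with
  | zero => exact ⟨0, Submodule.zero_mem _, by simp [hSeminorm]⟩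
  | succ n ih =>
    obtain ⟨hvd, -, hv'⟩ := contDiff_succ_iff_deriv (n := n).1 (by exact_mod_cast hv)
    obtain ⟨p, hp, hle⟩ := ih hv'
    obtain ⟨P, hP, rfl⟩ := exists_derivative_eq hp
    set Q := P + Polynomial.C (v l - P.eval l) with hQ
    have hderiv : deriv (fun x => v x - Q.eval x) = fun x => deriv v x - P.derivative.eval x := by
      ext x
      rw [deriv_fun_sub (hvd x) Q.differentiable.differentiableAt, Polynomial.deriv]
      simp [hQ]
    have hR : ContDiff ℝ 1 fun x => v x - Q.eval x :=
      (hv.of_le (by exact_mod_cast Nat.succ_pos n)).sub (Q.contDiff_aeval 1)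
    refine ⟨Q, Submodule.add_mem _ hP (mem_degreeLT_succ_iff.2 (by simp)), ?_⟩
    calc l2Norm l r (fun x => v x - Q.eval x)
        ≤ (r - l) * l2Norm l r (fun x => deriv v x - P.derivative.eval x) := by
          rw [← hderiv]
          exact l2Norm_le_mul_l2Norm_deriv hlr hR (by simp [hQ])
      _ ≤ (r - l) * ((r - l) ^ n * hSeminorm l r n (deriv v)) :=
          mul_le_mul_of_nonneg_left hle (sub_nonneg.2 hlr)
      _ = (r - l) ^ (n + 1) * hSeminorm l r (n + 1) v := by
          rw [hSeminorm, hSeminorm, iteratedDeriv_succ', pow_succ', mul_assoc]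

end PolynomialApproximation

section PeriodicSeminorm

variable {a b δ : ℝ}

theorem iteratedDeriv_periodic {v : ℝ → ℝ} {c : ℝ} (hv : Function.Periodic v c) (n : ℕ) :
    Function.Periodic (iteratedDeriv n v) c := fun x => by
  have h := congrFun (iteratedDeriv_comp_add_const n v c) x
  rwa [show (fun z => v (z + c)) = v from funext hv, eq_comm] at h

theorem iteratedDeriv_diffQuot {n : ℕ} {v : ℝ → ℝ} (hv : ContDiff ℝ n v) (s : ℝ) :
    iteratedDeriv n (diffQuot s v) = diffQuot s (iteratedDeriv n v) := by
  have h : ContDiff ℝ n fun x => v (x + s) := hv.comp (by fun_prop)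
  ext x
  unfold diffQuot
  rw [iteratedDeriv_const_mul_field, iteratedDeriv_fun_sub h.contDiffAt hv.contDiffAt,
    iteratedDeriv_comp_add_const]

/- By Rolle's theorem the derivative of a periodic function vanishes somewhere; start the period
there. -/
theorem l2Norm_deriv_le_of_periodic (hab : a < b) {v : ℝ → ℝ} (hv : ContDiff ℝ 2 v)
    (hp : Function.Periodic v (b - a)) :
    l2Norm a b (deriv v) ≤ (b - a) * l2Norm a b (deriv (deriv v)) := by
  obtain ⟨c, -, hc⟩ := exists_deriv_eq_zero hab hv.continuous.continuousOn
    (by simpa using (hp a).symm)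
  have hv' : ContDiff ℝ 1 (deriv v) := (contDiff_succ_iff_deriv.1 hv).2.2
  have hle := l2Norm_le_mul_l2Norm_deriv (r := c + (b - a)) (by linarith) hv' hc
  have hp1 : Function.Periodic (deriv v) (b - a) := by
    simpa only [iteratedDeriv_one] using iteratedDeriv_periodic hp 1
  have hp2 : Function.Periodic (deriv (deriv v)) (b - a) := by
    simpa only [iteratedDeriv_one] using iteratedDeriv_periodic hp1 1
  rwa [l2Norm_period hp1, l2Norm_period hp2, add_sub_cancel_left] at hle

theorem diffQuot_eq_integral_deriv {w : ℝ → ℝ} (hw : ContDiff ℝ 1 w) {s : ℝ} (hs : s ≠ 0)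
    (x : ℝ) : diffQuot s w x = ∫ θ in (0 : ℝ)..1, deriv w (x + s * θ) := by
  rw [intervalIntegral.integral_comp_add_mul _ hs, mul_zero, add_zero, mul_one,
    intervalIntegral.integral_deriv_eq_sub (fun y _ => hw.differentiable one_ne_zero y)
      (hw.continuous_deriv_one.intervalIntegrable _ _), diffQuot, smul_eq_mul, one_div]

theorem l2Norm_deriv_le_of_diffQuot (hδ : 0 < δ) {w : ℝ → ℝ} (hw : ContDiff ℝ 1 w) {B : ℝ}
    (hB : ∀ s ∈ Ioc 0 δ, l2Norm a b (diffQuot s w) ≤ B) : l2Norm a b (deriv w) ≤ B := by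
  set g : ℝ → ℝ → ℝ := fun s x => ∫ θ in (0 : ℝ)..1, deriv w (x + s * θ) with hg
  have hw' : Continuous (deriv w) := hw.continuous_deriv_one
  have hgc : Continuous fun p : ℝ × ℝ => g p.1 p.2 :=
    intervalIntegral.continuous_parametric_intervalIntegral_of_continuous'
      (f := fun (p : ℝ × ℝ) θ => deriv w (p.2 + p.1 * θ)) (hw'.comp (by fun_prop)) 0 1
  have hcont : Continuous fun s => l2Norm a b (g s) :=
    (intervalIntegral.continuous_parametric_intervalIntegral_of_continuous'
      (f := fun s x => g s x ^ 2) (by exact hgc.pow 2) a b).sqrt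
  have hg0 : g 0 = deriv w := by ext x; simp [hg]
  rw [← hg0]
  refine le_of_tendsto ((hcont.tendsto 0).mono_left (nhdsWithin_le_nhds (s := Ioi 0))) ?_
  filter_upwards [Ioc_mem_nhdsGT hδ] with s hs
  rw [show g s = diffQuot s w from funext fun x => (diffQuot_eq_integral_deriv hw hs.1.ne' x).symm]
  exact hB s hs

theorem hSeminorm_le_of_diffQuot (hab : a < b) (hδ : 0 < δ) {k : ℕ} {M : ℝ} {v : ℝ → ℝ}
    (hv : ContDiff ℝ (k + 2 : ℕ) v) (hp : Function.Periodic v (b - a))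
    (hM : ∀ s ∈ Ioc 0 δ, hSeminorm a b (k + 1) (diffQuot s v) ≤ M) :
    hSeminorm a b (k + 1) v ≤ (b - a) * M := by
  have hk : ContDiff ℝ 2 (iteratedDeriv k v) := by
    rw [iteratedDeriv_eq_iterate]
    exact ContDiff.iterate_deriv' 2 k (by exact_mod_cast add_comm k 2 ▸ hv)
  have hk1 : ContDiff ℝ 1 (iteratedDeriv (k + 1) v) := by
    rw [iteratedDeriv_succ]
    exact (contDiff_succ_iff_deriv.1 hk).2.2
  have hv1 : ContDiff ℝ (k + 1 : ℕ) v := hv.of_le (by exact_mod_cast Nat.le_succ _)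
  calc hSeminorm a b (k + 1) v
      ≤ (b - a) * l2Norm a b (deriv (iteratedDeriv (k + 1) v)) := by
        rw [hSeminorm, iteratedDeriv_succ]
        exact l2Norm_deriv_le_of_periodic hab hk (iteratedDeriv_periodic hp k)
    _ ≤ (b - a) * M := by
        refine mul_le_mul_of_nonneg_left (l2Norm_deriv_le_of_diffQuot hδ hk1 fun s hs => ?_)
          (sub_pos.2 hab).le
        rw [← iteratedDeriv_diffQuot hv1]
        exact hM s hs

end PeriodicSeminorm

section Periodic

variable {a b : ℝ}

theorem ae_eq_of_periodic (hab : a < b) {f g : ℝ → ℝ} (hf : Function.Periodic f (b - a))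
    (hg : Function.Periodic g (b - a)) (h : f =ᵐ[volume.restrict (Ioc a b)] g) :
    f =ᵐ[volume] g := by
  have hdom := isAddFundamentalDomain_Ioc (sub_pos.2 hab) a volume
  rw [add_sub_cancel] at hdom
  rw [EventuallyEq, ae_iff] at h ⊢
  refine hdom.measure_zero_of_invariant _ (fun c => ?_) ?_
  · obtain ⟨n, hn⟩ := AddSubgroup.mem_zmultiples_iff.1 c.2
    ext x
    rw [mem_vadd_set_iff_neg_vadd_mem, AddSubgroup.vadd_def, vadd_eq_add, AddSubgroup.coe_neg, ← hn,
      ← neg_smul, add_comm, mem_ofPred_eq, mem_ofPred_eq, hf.zsmul (-n) x, hg.zsmul (-n) x]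
  · rwa [Measure.restrict_apply' measurableSet_Ioc] at h

theorem integral_congr_of_eqOn_Ioo {l r : ℝ} (hlr : l ≤ r) {f g : ℝ → ℝ} (h : EqOn f g (Ioo l r)) :
    ∫ x in l..r, f x = ∫ x in l..r, g x := by
  rw [intervalIntegral.integral_of_le hlr, intervalIntegral.integral_of_le hlr,
    integral_Ioc_eq_integral_Ioo, integral_Ioc_eq_integral_Ioo]
  exact setIntegral_congr_fun measurableSet_Ioo h

end Periodic

namespace Mesh

section DGSpace

variable {a b : ℝ} (m : Mesh a b)

theorem left_lt_right (j : Fin m.N) : m.left j < m.right j :=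
  m.strictMono Fin.castSucc_lt_succ

theorem le_left (j : Fin m.N) : a ≤ m.left j :=
  m.node_first.symm.trans_le (m.strictMono.monotone (Fin.zero_le _))

theorem right_le (j : Fin m.N) : m.right j ≤ b :=
  (m.strictMono.monotone (Fin.le_last _)).trans_eq m.node_last

theorem cell_subset (j : Fin m.N) : m.cell j ⊆ Ioo a b :=
  Ioo_subset_Ioo (m.le_left j) (m.right_le j)

theorem measurableSet_cell (j : Fin m.N) : MeasurableSet (m.cell j) :=
  measurableSet_Ioo

theorem length_le_size (j : Fin m.N) : m.length j ≤ m.size :=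
  le_ciSup (f := m.length) (Set.finite_range _).bddAbove j

theorem size_nonneg : 0 ≤ m.size :=
  Real.iSup_nonneg fun j => sub_nonneg.2 (m.left_lt_right j).le

theorem disjoint_cell {i j : Fin m.N} (hij : i ≠ j) : Disjoint (m.cell i) (m.cell j) := by
  wlog h : i < j generalizing i j
  · exact (this hij.symm (hij.symm.lt_of_le (not_lt.1 h))).symm
  have hle : m.right i ≤ m.left j :=
    m.strictMono.monotone (Fin.le_def.2 (by simpa using h))
  exact Set.disjoint_left.2 fun y hi hj => (hj.1.trans hi.2).not_ge hle

theorem exists_mem_cell {y : ℝ} (hy : y ∈ Icc a b) (hn : y ∉ range m.node) :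
    ∃ j, y ∈ m.cell j := by
  by_contra! h
  have hlt : ∀ i : Fin (m.N + 1), m.node i < y := fun i => by
    induction i using Fin.induction with
    | zero => exact (m.node_first.trans_le hy.1).lt_of_ne fun e => hn ⟨0, e⟩
    | succ j ih => exact (not_lt.1 fun hj => h j ⟨ih, hj⟩).lt_of_ne fun e => hn ⟨_, e⟩
  exact (m.node_last.symm.trans_lt (hlt _)).not_ge hy.2

theorem ae_exists_mem_cell : ∀ᵐ x ∂volume.restrict (Ioc a b), ∃ j, x ∈ m.cell j := by
  filter_upwards [ae_restrict_mem measurableSet_Ioc,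
    ae_restrict_of_ae ((Set.finite_range m.node).countable.ae_notMem volume)] with x hx hn
  exact m.exists_mem_cell (Ioc_subset_Icc_self hx) hn

theorem sum_integral_cell (hab : a ≤ b) {f : ℝ → ℝ} (hf : IntervalIntegrable f volume a b) :
    ∑ j, ∫ x in (m.left j)..(m.right j), f x = ∫ x in a..b, f x := by
  have hcover : (⋃ j, m.cell j : Set ℝ) =ᵐ[volume] Ioc a b := by
    refine (LE.le.eventuallyLE (iUnion_subset fun j =>
      (m.cell_subset j).trans Ioo_subset_Ioc_self)).antisymm ?_
    filter_upwards [(ae_restrict_iff' measurableSet_Ioc).1 m.ae_exists_mem_cell] with x hx hxab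
    exact mem_iUnion.2 (hx hxab)
  rw [intervalIntegral.integral_of_le hab, ← setIntegral_congr_set hcover,
    integral_iUnion_fintype m.measurableSet_cell (fun _ _ => m.disjoint_cell) fun j =>
      hf.1.mono_set ((m.cell_subset j).trans Ioo_subset_Ioc_self)]
  refine Finset.sum_congr rfl fun j _ => ?_
  rw [intervalIntegral.integral_of_le (m.left_lt_right j).le, integral_Ioc_eq_integral_Ioo]
  rfl

section Piecewise

variable (hab : a < b) {k : ℕ}

/-- The `(b - a)`-periodic function that agrees with the polynomial `P j` on the `j`-th cell and
vanishes at the nodes, as a linear map in `P`. -/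
noncomputable def piecewise (k : ℕ) :
    (Fin m.N → Polynomial.degreeLT ℝ (k + 1)) →ₗ[ℝ] ℝ → ℝ where
  toFun P x := ∑ j, (m.cell j).indicator (fun y => (P j : Polynomial ℝ).eval y)
    (toIcoMod (sub_pos.2 hab) a x)
  map_add' P Q := by
    ext x
    simp [indicator_add, Finset.sum_add_distrib]
  map_smul' c P := by
    ext x
    simp [Finset.mul_sum, indicator_const_mul]

theorem piecewise_apply (P : Fin m.N → Polynomial.degreeLT ℝ (k + 1)) (x : ℝ) :
    m.piecewise hab k P x = ∑ j, (m.cell j).indicator (fun y => (P j : Polynomial ℝ).eval y)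
      (toIcoMod (sub_pos.2 hab) a x) :=
  rfl

theorem piecewise_of_mem (P : Fin m.N → Polynomial.degreeLT ℝ (k + 1)) {x : ℝ} {j : Fin m.N}
    (hx : x ∈ m.cell j) : m.piecewise hab k P x = (P j : Polynomial ℝ).eval x := by
  have hmod : toIcoMod (sub_pos.2 hab) a x = x := by
    rw [toIcoMod_eq_self, add_sub_cancel]
    exact Ioo_subset_Ico_self (m.cell_subset j hx)
  rw [piecewise_apply, hmod, Finset.sum_eq_single_of_mem j
    (Finset.mem_univ j) fun i _ hij => indicator_of_notMem (fun hi =>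
      Set.disjoint_left.1 (m.disjoint_cell hij) hi hx) _, indicator_of_mem hx]

theorem piecewise_mem_dgSpace (P : Fin m.N → Polynomial.degreeLT ℝ (k + 1)) :
    m.piecewise hab k P ∈ m.dgSpace k :=
  ⟨fun x => by simp only [piecewise_apply, toIcoMod_periodic _ a x],
    fun j => ⟨P j, mem_degreeLT_succ_iff.1 (P j).2, fun _ hx => m.piecewise_of_mem hab P hx⟩⟩

theorem measurable_piecewise (P : Fin m.N → Polynomial.degreeLT ℝ (k + 1)) :
    Measurable (m.piecewise hab k P) := by
  have hmod : Measurable (toIcoMod (sub_pos.2 hab) a) := by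
    simp only [funext (toIcoMod_eq_add_fract_mul (sub_pos.2 hab) a)]
    fun_prop
  simp only [funext (m.piecewise_apply hab P)]
  exact Finset.measurable_sum _ fun j _ =>
    ((P j : Polynomial ℝ).continuous.measurable.indicator (m.measurableSet_cell j)).comp hmod

theorem memLp_top_piecewise (P : Fin m.N → Polynomial.degreeLT ℝ (k + 1)) :
    MemLp (m.piecewise hab k P) ⊤ volume := by
  choose C hC using fun j => (isCompact_Icc (a := a) (b := b)).exists_bound_of_continuousOn
    (P j : Polynomial ℝ).continuous.continuousOn
  refine memLp_top_of_bound (m.measurable_piecewise hab P).aestronglyMeasurable (∑ j, C j)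
    (.of_forall fun x => ?_)
  rw [piecewise_apply]
  refine (norm_sum_le _ _).trans (Finset.sum_le_sum fun j _ => ?_)
  refine norm_indicator_le_norm_self _ _ |>.trans (hC j _ ?_)
  have hx := toIcoMod_mem_Ico (sub_pos.2 hab) a x
  rw [add_sub_cancel] at hx
  exact Ico_subset_Icc_self hx

theorem exists_ae_eq_piecewise {v : ℝ → ℝ} (hv : v ∈ m.dgSpace k) :
    ∃ P, v =ᵐ[volume] m.piecewise hab k P := by
  choose P hP hPv using hv.2
  refine ⟨fun j => ⟨P j, mem_degreeLT_succ_iff.2 (hP j)⟩, ae_eq_of_periodic hab hv.1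
    (m.piecewise_mem_dgSpace hab _).1 ?_⟩
  filter_upwards [m.ae_exists_mem_cell] with x ⟨j, hj⟩
  rw [m.piecewise_of_mem hab _ hj, hPv j x hj]

end Piecewise

variable {m} {k : ℕ} {v w : ℝ → ℝ}

theorem memLp_top_of_mem_dgSpace (hab : a < b) (hv : v ∈ m.dgSpace k) : MemLp v ⊤ volume := by
  obtain ⟨P, hP⟩ := m.exists_ae_eq_piecewise hab hv
  exact (memLp_congr_ae hP).2 (m.memLp_top_piecewise hab P)

theorem sub_mem_dgSpace (hv : v ∈ m.dgSpace k) (hw : w ∈ m.dgSpace k) :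
    (fun x => v x - w x) ∈ m.dgSpace k :=
  ⟨hv.1.sub hw.1, fun j => by
    obtain ⟨p, hp, hpv⟩ := hv.2 j
    obtain ⟨q, hq, hqw⟩ := hw.2 j
    refine ⟨p - q, Polynomial.natDegree_sub_le_of_le hp hq |>.trans_eq (max_self k),
      fun x hx => ?_⟩
    simp only [hpv x hx, hqw x hx, Polynomial.eval_sub]⟩

end DGSpace

section OrthonormalBasis

variable {a b : ℝ} {k : ℕ} {ι : Type*}

/-- The coefficients of the `L²(a, b)`-projection of `f` in the orthonormal system `φ`. -/
noncomputable def coeffs (a b : ℝ) (φ : ι → ℝ → ℝ) (f : ℝ → ℝ) : EuclideanSpace ℝ ι :=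
  WithLp.toLp 2 fun i => ∫ x in a..b, f x * φ i x

theorem coeffs_sub {φ : ι → ℝ → ℝ} (hφ : ∀ i, MemLp (φ i) ⊤ volume)
    {f g : ℝ → ℝ} (hf : MemLp f ⊤ volume) (hg : MemLp g ⊤ volume) :
    coeffs a b φ (fun x => f x - g x) = coeffs a b φ f - coeffs a b φ g := by
  ext i
  simp only [coeffs, PiLp.sub_apply, sub_mul]
  exact intervalIntegral.integral_sub
    (intervalIntegrable_of_memLp_top (memLp_top_mul hf (hφ i)) a b)
    (intervalIntegrable_of_memLp_top (memLp_top_mul hg (hφ i)) a b)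

variable [Fintype ι]

/-- `φ` consists of measurable representatives of an `L²(a, b)`-orthonormal basis of `V_h^k`. -/
structure IsOrthonormalBasis [DecidableEq ι] (m : Mesh a b) (k : ℕ) (φ : ι → ℝ → ℝ) : Prop where
  mem : ∀ i, φ i ∈ m.dgSpace k
  measurable : ∀ i, Measurable (φ i)
  orthonormal : ∀ i j, ∫ x in a..b, φ i x * φ j x = if i = j then 1 else 0
  expand : ∀ v ∈ m.dgSpace k, v =ᵐ[volume] fun x => ∑ i, (∫ y in a..b, v y * φ i y) * φ i x

/-- The map to `L²(a, b)` whose range is `V_h^k`. -/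
noncomputable def piecewiseToLp (m : Mesh a b) (hab : a < b) (k : ℕ) :
    (Fin m.N → Polynomial.degreeLT ℝ (k + 1)) →ₗ[ℝ] Lp ℝ 2 (volume.restrict (Ioc a b)) where
  toFun P := (memLp_two_Ioc_of_memLp_top (m.memLp_top_piecewise hab P) a b).toLp
  map_add' P Q := by
    simp only [map_add]
    exact MemLp.toLp_add _ _
  map_smul' c P := by
    simp only [map_smul]
    exact MemLp.toLp_const_smul c _

theorem inner_piecewiseToLp (m : Mesh a b) (hab : a < b)
    (P Q : Fin m.N → Polynomial.degreeLT ℝ (k + 1)) :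
    inner ℝ (m.piecewiseToLp hab k P) (m.piecewiseToLp hab k Q)
      = ∫ x in a..b, m.piecewise hab k P x * m.piecewise hab k Q x :=
  inner_toLp_eq_integral hab.le (memLp_two_Ioc_of_memLp_top (m.memLp_top_piecewise hab P) a b)
    (memLp_two_Ioc_of_memLp_top (m.memLp_top_piecewise hab Q) a b)

theorem piecewise_ae_eq_of_toLp_eq (m : Mesh a b) (hab : a < b)
    {P Q : Fin m.N → Polynomial.degreeLT ℝ (k + 1)}
    (h : m.piecewiseToLp hab k P = m.piecewiseToLp hab k Q) :
    m.piecewise hab k P =ᵐ[volume] m.piecewise hab k Q :=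
  ae_eq_of_periodic hab (m.piecewise_mem_dgSpace hab P).1 (m.piecewise_mem_dgSpace hab Q).1
    ((MemLp.toLp_eq_toLp_iff (memLp_two_Ioc_of_memLp_top (m.memLp_top_piecewise hab P) a b)
      (memLp_two_Ioc_of_memLp_top (m.memLp_top_piecewise hab Q) a b)).1 h)

theorem sum_mul_mem_dgSpace {m : Mesh a b} (c : ι → ℝ) {φ : ι → ℝ → ℝ}
    (hφ : ∀ i, φ i ∈ m.dgSpace k) : (fun x => ∑ i, c i * φ i x) ∈ m.dgSpace k := by
  refine ⟨fun x => Finset.sum_congr rfl fun i _ => by rw [(hφ i).1 x], fun j => ?_⟩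
  choose p hp hpe using fun i => (hφ i).2 j
  refine ⟨∑ i, Polynomial.C (c i) * p i,
    Polynomial.natDegree_sum_le_of_forall_le _ _ fun i _ =>
      (Polynomial.natDegree_C_mul_le _ _).trans (hp i), fun x hx => ?_⟩
  simp only [Polynomial.eval_finsetSum, Polynomial.eval_mul, Polynomial.eval_C, hpe _ x hx]

theorem exists_isOrthonormalBasis (m : Mesh a b) (hab : a < b) (k : ℕ) :
    ∃ (n : ℕ) (φ : Fin n → ℝ → ℝ), m.IsOrthonormalBasis k φ := by
  have : Module.Finite ℝ (Polynomial.degreeLT ℝ (k + 1)) :=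
    Module.Finite.equiv (Polynomial.degreeLTEquiv ℝ (k + 1)).symm
  set Λ := m.piecewiseToLp hab k
  set e := stdOrthonormalBasis ℝ (LinearMap.range Λ)
  choose P hP using fun i => (e i).2
  refine ⟨_, fun i => m.piecewise hab k (P i), fun i => m.piecewise_mem_dgSpace hab _,
    fun i => m.measurable_piecewise hab _, fun i j => ?_, fun v hv => ?_⟩
  · rw [← inner_piecewiseToLp, hP, hP, ← Submodule.coe_inner]
    exact orthonormal_iff_ite.1 e.orthonormal i j
  · obtain ⟨Q, hQ⟩ := m.exists_ae_eq_piecewise hab hv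
    have hcoef : ∀ i, ∫ y in a..b, v y * m.piecewise hab k (P i) y = inner ℝ (Λ (P i)) (Λ Q) :=
      fun i => by
        rw [real_inner_comm, inner_piecewiseToLp]
        exact intervalIntegral.integral_congr_ae (hQ.mono fun x hx _ => by simp only [hx])
    have hsum : Λ Q = Λ (∑ i, inner ℝ (Λ (P i)) (Λ Q) • P i) := by
      have h := congrArg Subtype.val (e.sum_repr' ⟨Λ Q, LinearMap.mem_range_self Λ Q⟩)
      simp only [Submodule.coe_sum, Submodule.coe_smul, Submodule.coe_inner, ← hP] at h
      simp only [map_sum, map_smul, h]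
    filter_upwards [hQ, m.piecewise_ae_eq_of_toLp_eq hab hsum] with x hvx hx
    rw [hvx, hx, map_sum, Finset.sum_apply]
    simp only [map_smul, Pi.smul_apply, smul_eq_mul, hcoef]

namespace IsOrthonormalBasis

variable [DecidableEq ι] {m : Mesh a b} {φ : ι → ℝ → ℝ} {f v : ℝ → ℝ}

theorem memLp_top (hφ : m.IsOrthonormalBasis k φ) (hab : a < b) (i : ι) :
    MemLp (φ i) ⊤ volume :=
  memLp_top_of_mem_dgSpace hab (hφ.mem i)

theorem integral_mul_eq_inner (hφ : m.IsOrthonormalBasis k φ) (hab : a < b)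
    (hf : MemLp f ⊤ volume) (hv : v ∈ m.dgSpace k) :
    ∫ x in a..b, f x * v x = inner ℝ (coeffs a b φ f) (coeffs a b φ v) := by
  calc ∫ x in a..b, f x * v x
      = ∫ x in a..b, ∑ i, coeffs a b φ v i * (f x * φ i x) := by
        refine intervalIntegral.integral_congr_ae ?_
        filter_upwards [hφ.expand v hv] with x hx _
        rw [hx, Finset.mul_sum]
        exact Finset.sum_congr rfl fun i _ => mul_left_comm _ _ _
    _ = ∑ i, coeffs a b φ v i * coeffs a b φ f i := by
        rw [intervalIntegral.integral_finsetSum fun i _ => (intervalIntegrable_of_memLp_top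
          (memLp_top_mul hf (hφ.memLp_top hab i)) a b).const_mul _]
        simp only [intervalIntegral.integral_const_mul, coeffs]
    _ = inner ℝ (coeffs a b φ f) (coeffs a b φ v) := by
        rw [PiLp.inner_apply]
        rfl

theorem l2Norm_eq_norm_coeffs (hφ : m.IsOrthonormalBasis k φ) (hab : a < b)
    (hv : v ∈ m.dgSpace k) : l2Norm a b v = ‖coeffs a b φ v‖ := by
  rw [norm_eq_sqrt_real_inner, l2Norm,
    ← hφ.integral_mul_eq_inner hab (memLp_top_of_mem_dgSpace hab hv) hv]
  simp only [pow_two]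

theorem exists_coeffs_eq (hφ : m.IsOrthonormalBasis k φ) (hab : a < b)
    (c : EuclideanSpace ℝ ι) : ∃ v ∈ m.dgSpace k, coeffs a b φ v = c := by
  refine ⟨fun x => ∑ i, c i * φ i x, sum_mul_mem_dgSpace _ hφ.mem, ?_⟩
  ext i
  simp only [coeffs, Finset.sum_mul, mul_assoc]
  rw [intervalIntegral.integral_finsetSum fun j _ => (intervalIntegrable_of_memLp_top
    (memLp_top_mul (hφ.memLp_top hab j) (hφ.memLp_top hab i)) a b).const_mul _]
  simp only [intervalIntegral.integral_const_mul, hφ.orthonormal, mul_ite, mul_one, mul_zero,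
    Finset.sum_ite_eq', Finset.mem_univ, if_true]

theorem norm_coeffs_le (hφ : m.IsOrthonormalBasis k φ) (hab : a < b) (hf : MemLp f ⊤ volume)
    {B : ℝ} (hB : 0 ≤ B) (h : ∀ v ∈ m.dgSpace k, |∫ x in a..b, f x * v x| ≤ B * l2Norm a b v) :
    ‖coeffs a b φ f‖ ≤ B := by
  obtain ⟨v, hv, hvf⟩ := hφ.exists_coeffs_eq hab (coeffs a b φ f)
  have hsq := (le_abs_self _).trans (h v hv)
  rw [hφ.integral_mul_eq_inner hab hf hv, hφ.l2Norm_eq_norm_coeffs hab hv, hvf,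
    real_inner_self_eq_norm_mul_norm] at hsq
  rcases (norm_nonneg (coeffs a b φ f)).eq_or_lt with h0 | h0
  · rwa [← h0]
  · exact le_of_mul_le_mul_right hsq h0

theorem norm_coeffs_le_l2Norm (hφ : m.IsOrthonormalBasis k φ) (hab : a < b)
    (hf : MemLp f ⊤ volume) : ‖coeffs a b φ f‖ ≤ l2Norm a b f :=
  hφ.norm_coeffs_le hab hf (l2Norm_nonneg _ _ _) fun _ hv =>
    abs_integral_mul_le hab.le (memLp_two_Ioc_of_memLp_top hf a b)
      (memLp_two_Ioc_of_memLp_top (memLp_top_of_mem_dgSpace hab hv) a b)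

end IsOrthonormalBasis

end OrthonormalBasis

section Approximation

variable {a b : ℝ} {k : ℕ} {m : Mesh a b} {f v w : ℝ → ℝ}

theorem l2Norm_sq_eq_sum_cell (hab : a ≤ b) (hf : MemLp f 2 (volume.restrict (Ioc a b))) :
    l2Norm a b f ^ 2 = ∑ j, l2Norm (m.left j) (m.right j) f ^ 2 := by
  rw [l2Norm_sq hab, ← m.sum_integral_cell hab
    ((intervalIntegrable_iff_integrableOn_Ioc_of_le hab).2 hf.integrable_sq)]
  exact Finset.sum_congr rfl fun j _ => (l2Norm_sq (m.left_lt_right j).le f).symm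

theorem exists_l2Norm_sub_le (m : Mesh a b) (hab : a < b) (hf : ContDiff ℝ (k + 1 : ℕ) f) :
    ∃ v ∈ m.dgSpace k,
      l2Norm a b (fun x => f x - v x) ≤ m.size ^ (k + 1) * hSeminorm a b (k + 1) f := by
  choose p hp hpf using fun j => exists_polynomial_l2Norm_sub_le (m.left_lt_right j).le hf
  set v := m.piecewise hab k fun j => ⟨p j, hp j⟩
  have hv2 : MemLp (fun x => f x - v x) 2 (volume.restrict (Ioc a b)) :=
    (memLp_two_Ioc_of_continuous hf.continuous a b).sub
      (memLp_two_Ioc_of_memLp_top (m.memLp_top_piecewise hab _) a b)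
  have hf2 : MemLp (iteratedDeriv (k + 1) f) 2 (volume.restrict (Ioc a b)) :=
    memLp_two_Ioc_of_continuous (hf.continuous_iteratedDeriv (k + 1) le_rfl) a b
  refine ⟨v, m.piecewise_mem_dgSpace hab _, (sq_le_sq₀ (l2Norm_nonneg _ _ _)
    (mul_nonneg (pow_nonneg m.size_nonneg _) (l2Norm_nonneg _ _ _))).1 ?_⟩
  rw [mul_pow, l2Norm_sq_eq_sum_cell hab.le hv2 (m := m),
    l2Norm_sq_eq_sum_cell hab.le hf2 (m := m), Finset.mul_sum]
  refine Finset.sum_le_sum fun j _ => ?_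
  have hcell : l2Norm (m.left j) (m.right j) (fun x => f x - v x)
      = l2Norm (m.left j) (m.right j) fun x => f x - (p j).eval x :=
    congrArg Real.sqrt <| integral_congr_of_eqOn_Ioo (m.left_lt_right j).le fun x hx => by
      simp only [v, m.piecewise_of_mem hab _ hx]
  rw [hcell, ← mul_pow]
  exact pow_le_pow_left₀ (l2Norm_nonneg _ _ _) ((hpf j).trans (mul_le_mul_of_nonneg_right
    (pow_le_pow_left₀ (sub_nonneg.2 (m.left_lt_right j).le) (m.length_le_size j) _)
    (l2Norm_nonneg _ _ _))) 2

variable {ι : Type*} {φ : ι → ℝ → ℝ}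

theorem IsL2Projection.integral_mul_eq (h : m.IsL2Projection k f w) (hab : a < b)
    (hf : MemLp f ⊤ volume) (hv : v ∈ m.dgSpace k) :
    ∫ x in a..b, f x * v x = ∫ x in a..b, w x * v x := by
  have hw := memLp_top_of_mem_dgSpace hab h.1
  have hvm := memLp_top_of_mem_dgSpace hab hv
  rw [← sub_eq_zero, ← intervalIntegral.integral_sub
    (intervalIntegrable_of_memLp_top (memLp_top_mul hf hvm) a b)
    (intervalIntegrable_of_memLp_top (memLp_top_mul hw hvm) a b),
    ← m.sum_integral_cell hab.le (f := fun x => f x * v x - w x * v x)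
      (intervalIntegrable_of_memLp_top ((memLp_top_mul hf hvm).sub (memLp_top_mul hw hvm)) a b)]
  refine Finset.sum_eq_zero fun j _ => ?_
  obtain ⟨p, hp, hpv⟩ := hv.2 j
  rw [← h.2 j p hp]
  exact integral_congr_of_eqOn_Ioo (m.left_lt_right j).le fun x hx => by
    simp only [hpv x hx, sub_mul]

theorem IsL2Projection.coeffs_eq (h : m.IsL2Projection k f w) (hab : a < b)
    (hf : MemLp f ⊤ volume) (hφ : ∀ i, φ i ∈ m.dgSpace k) :
    coeffs a b φ f = coeffs a b φ w := by
  ext i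
  exact h.integral_mul_eq hab hf (hφ i)

variable [Fintype ι] [DecidableEq ι]

theorem IsL2Projection.coeffs_sub_eq_zero (h : m.IsL2Projection k f w) (hab : a < b)
    (hf : MemLp f ⊤ volume) (hφ : m.IsOrthonormalBasis k φ) :
    coeffs a b φ (fun x => w x - f x) = 0 := by
  rw [coeffs_sub (hφ.memLp_top hab) (memLp_top_of_mem_dgSpace hab h.1) hf,
    h.coeffs_eq hab hf hφ.mem, sub_self]

theorem IsOrthonormalBasis.l2Norm_sub_le (hφ : m.IsOrthonormalBasis k φ) (hab : a < b)
    (hv : v ∈ m.dgSpace k) (hf : ContDiff ℝ (k + 1 : ℕ) f) (hp : Function.Periodic f (b - a)) :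
    l2Norm a b (fun x => v x - f x) ≤ ‖coeffs a b φ (fun x => v x - f x)‖
      + 2 * (m.size ^ (k + 1) * hSeminorm a b (k + 1) f) := by
  obtain ⟨w, hw, hwf⟩ := m.exists_l2Norm_sub_le hab hf
  have hfm := memLp_top_of_continuous_periodic (sub_pos.2 hab) hf.continuous hp
  have hvm := memLp_top_of_mem_dgSpace hab hv
  have hwm := memLp_top_of_mem_dgSpace hab hw
  have hφm := hφ.memLp_top hab
  have htri := l2Norm_sub_le_sub_add_sub hab.le (memLp_two_Ioc_of_memLp_top hvm a b)
    (memLp_two_Ioc_of_memLp_top hwm a b) (memLp_two_Ioc_of_memLp_top hfm a b)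
  have hdiscrete : l2Norm a b (fun x => v x - w x)
      ≤ ‖coeffs a b φ fun x => v x - f x‖ + l2Norm a b fun x => f x - w x :=
    calc l2Norm a b (fun x => v x - w x)
        = ‖coeffs a b φ (fun x => v x - f x) + coeffs a b φ fun x => f x - w x‖ := by
          rw [hφ.l2Norm_eq_norm_coeffs hab (sub_mem_dgSpace hv hw), coeffs_sub hφm hvm hwm,
            coeffs_sub hφm hvm hfm, coeffs_sub hφm hfm hwm, sub_add_sub_cancel]
      _ ≤ _ := (norm_add_le _ _).trans
          (add_le_add_right (hφ.norm_coeffs_le_l2Norm hab (hfm.sub hwm)) _)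
  rw [l2Norm_sub_comm a b w f] at htri
  linarith

theorem IsL2Projection.l2Norm_sub_le {g : ℝ → ℝ} (h : m.IsL2Projection k g w) (hab : a < b)
    (hg : MemLp g ⊤ volume) (hf : ContDiff ℝ (k + 1 : ℕ) f)
    (hp : Function.Periodic f (b - a)) :
    l2Norm a b (fun x => w x - f x) ≤ l2Norm a b (fun x => g x - f x)
      + 2 * (m.size ^ (k + 1) * hSeminorm a b (k + 1) f) := by
  obtain ⟨n, φ, hφ⟩ := m.exists_isOrthonormalBasis hab k
  have hfm := memLp_top_of_continuous_periodic (sub_pos.2 hab) hf.continuous hp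
  have hφm := hφ.memLp_top hab
  refine (hφ.l2Norm_sub_le hab h.1 hf hp).trans (add_le_add_left ?_ _)
  rw [coeffs_sub hφm (memLp_top_of_mem_dgSpace hab h.1) hfm, ← h.coeffs_eq hab hg hφ.mem,
    ← coeffs_sub hφm hg hfm]
  exact hφ.norm_coeffs_le_l2Norm hab (hg.sub hfm)

end Approximation

end Mesh

section TimeDerivative

variable {a b T : ℝ} {w w' v v' : ℝ → ℝ → ℝ}

theorem hasDerivWithinAt_dt {x t : ℝ} (h : DifferentiableOn ℝ (fun τ => w x τ) (Icc 0 T))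
    (ht : t ∈ Icc 0 T) : HasDerivWithinAt (fun τ => w x τ) (dt T w x t) (Icc 0 T) t :=
  (h t ht).hasDerivWithinAt

theorem dt_periodic {c : ℝ} (hw : ∀ t ∈ Icc 0 T, Function.Periodic (fun x => w x t) c) {t : ℝ}
    (ht : t ∈ Icc 0 T) : Function.Periodic (fun x => dt T w x t) c := fun x =>
  derivWithin_congr (fun τ hτ => hw τ hτ x) (hw t ht x)

/-- The family `w(·, t)` of essentially bounded functions is differentiable in time on `(0, T)`
with derivative `w'(·, t)`, and continuous on `[0, T]`, in the weak sense, i.e. after integration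
over `(a, b)` against any essentially bounded function. -/
structure HasWeakTimeDeriv (a b T : ℝ) (w w' : ℝ → ℝ → ℝ) : Prop where
  memLp_top : ∀ t ∈ Icc 0 T, MemLp (fun x => w x t) ⊤ volume
  memLp_top_deriv : ∀ t ∈ Icc 0 T, MemLp (fun x => w' x t) ⊤ volume
  continuousOn : ∀ {g : ℝ → ℝ}, MemLp g ⊤ volume →
    ContinuousOn (fun t => ∫ x in a..b, w x t * g x) (Icc 0 T)
  hasDerivAt : ∀ {g : ℝ → ℝ}, MemLp g ⊤ volume → ∀ t ∈ Ioo 0 T,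
    HasDerivAt (fun τ => ∫ x in a..b, w x τ * g x) (∫ x in a..b, w' x t * g x) t

namespace HasWeakTimeDeriv

theorem sub (hw : HasWeakTimeDeriv a b T w w') (hv : HasWeakTimeDeriv a b T v v') :
    HasWeakTimeDeriv a b T (fun x t => w x t - v x t) fun x t => w' x t - v' x t := by
  have hsub : ∀ {f₁ f₂ g : ℝ → ℝ}, MemLp f₁ ⊤ volume → MemLp f₂ ⊤ volume → MemLp g ⊤ volume →
      ∫ x in a..b, (f₁ x - f₂ x) * g x
        = (∫ x in a..b, f₁ x * g x) - ∫ x in a..b, f₂ x * g x := fun h₁ h₂ hg => by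
    simp only [sub_mul]
    exact intervalIntegral.integral_sub (intervalIntegrable_of_memLp_top (memLp_top_mul h₁ hg) a b)
      (intervalIntegrable_of_memLp_top (memLp_top_mul h₂ hg) a b)
  refine ⟨fun t ht => (hw.memLp_top t ht).sub (hv.memLp_top t ht),
    fun t ht => (hw.memLp_top_deriv t ht).sub (hv.memLp_top_deriv t ht), fun hg => ?_,
    fun hg t ht => ?_⟩
  · exact ((hw.continuousOn hg).sub (hv.continuousOn hg)).congr fun t ht =>
      hsub (hw.memLp_top t ht) (hv.memLp_top t ht) hg
  · have hmem := Ioo_subset_Icc_self ht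
    rw [hsub (hw.memLp_top_deriv t hmem) (hv.memLp_top_deriv t hmem) hg]
    refine ((hw.hasDerivAt hg t ht).sub (hv.hasDerivAt hg t ht)).congr_of_eventuallyEq ?_
    filter_upwards [isOpen_Ioo.mem_nhds ht] with τ hτ
    exact hsub (hw.memLp_top τ (Ioo_subset_Icc_self hτ)) (hv.memLp_top τ (Ioo_subset_Icc_self hτ))
      hg

variable {ι : Type*} {φ : ι → ℝ → ℝ}

theorem continuousOn_coeffs (hw : HasWeakTimeDeriv a b T w w')
    (hφ : ∀ i, MemLp (φ i) ⊤ volume) :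
    ContinuousOn (fun t => Mesh.coeffs a b φ fun x => w x t) (Icc 0 T) :=
  (PiLp.continuous_toLp 2 _).comp_continuousOn
    (continuousOn_pi.2 fun i => hw.continuousOn (hφ i))

theorem hasDerivAt_coeffs [Fintype ι] (hw : HasWeakTimeDeriv a b T w w')
    (hφ : ∀ i, MemLp (φ i) ⊤ volume) {t : ℝ} (ht : t ∈ Ioo 0 T) :
    HasDerivAt (fun τ => Mesh.coeffs a b φ fun x => w x τ)
      (Mesh.coeffs a b φ fun x => w' x t) t :=
  (PiLp.continuousLinearEquiv 2 ℝ fun _ : ι => ℝ).symm.hasFDerivAt.comp_hasDerivAt t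
    (hasDerivAt_pi.2 fun i => hw.hasDerivAt (hφ i) t ht)

end HasWeakTimeDeriv

section DGFamilies

variable {m : Mesh a b} {k : ℕ}

theorem Mesh.exists_interpolation (m : Mesh a b) (k : ℕ) (j : Fin m.N) :
    ∃ (y : Fin (k + 1) → ℝ) (p : Fin (k + 1) → Polynomial ℝ), (∀ i, y i ∈ m.cell j) ∧
      (∀ i, (p i).natDegree ≤ k) ∧
      ∀ v ∈ m.dgSpace k, ∀ x ∈ m.cell j, v x = ∑ i, v (y i) * (p i).eval x := by
  obtain ⟨s, hs, hcard⟩ := (Ioo_infinite (m.left_lt_right j)).exists_subset_card_eq (k + 1)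
  let e : Fin (k + 1) ≃ s := (s.equivFinOfCardEq hcard).symm
  have hinj : Function.Injective fun i => (e i : ℝ) := Subtype.val_injective.comp e.injective
  have hy : ∀ i, (e i : ℝ) ∈ m.cell j := fun i => hs (e i).2
  refine ⟨fun i => e i, Lagrange.basis Finset.univ fun i => (e i : ℝ), hy, fun i => ?_,
    fun v hv x hx => ?_⟩
  · refine Polynomial.natDegree_le_of_degree_le ?_
    rw [Lagrange.degree_basis hinj.injOn (Finset.mem_univ i), Finset.card_univ, Fintype.card_fin,
      Nat.add_sub_cancel]
  · obtain ⟨p, hp, hpe⟩ := hv.2 j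
    have hdeg : p.degree < (Finset.univ : Finset (Fin (k + 1))).card := by
      rw [Finset.card_univ, Fintype.card_fin]
      exact Polynomial.mem_degreeLT.1 (mem_degreeLT_succ_iff.2 hp)
    rw [hpe x hx, Lagrange.eq_interpolate hinj.injOn hdeg, Lagrange.interpolate_apply,
      Polynomial.eval_finsetSum]
    refine Finset.sum_congr rfl fun i _ => ?_
    rw [Polynomial.eval_mul, Polynomial.eval_C, hpe _ (hy i)]

theorem Mesh.dt_mem_dgSpace (hT : 0 < T) (hw : ∀ t ∈ Icc 0 T, (fun x => w x t) ∈ m.dgSpace k)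
    (hd : ∀ j, ∀ x ∈ m.cell j, DifferentiableOn ℝ (fun t => w x t) (Icc 0 T)) {t : ℝ}
    (ht : t ∈ Icc 0 T) : (fun x => dt T w x t) ∈ m.dgSpace k := by
  refine ⟨dt_periodic (fun τ hτ => (hw τ hτ).1) ht, fun j => ?_⟩
  obtain ⟨y, p, hy, hp, hrep⟩ := m.exists_interpolation k j
  refine ⟨∑ i, Polynomial.C (dt T w (y i) t) * p i,
    Polynomial.natDegree_sum_le_of_forall_le _ _ fun i _ =>
      (Polynomial.natDegree_C_mul_le _ _).trans (hp i), fun x hx => ?_⟩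
  have hderiv : HasDerivWithinAt (fun τ => ∑ i, w (y i) τ * (p i).eval x)
      (∑ i, dt T w (y i) t * (p i).eval x) (Icc 0 T) t :=
    HasDerivWithinAt.fun_sum fun i _ => (hasDerivWithinAt_dt (hd j _ (hy i)) ht).mul_const _
  simp only [Polynomial.eval_finsetSum, Polynomial.eval_mul, Polynomial.eval_C]
  exact (hderiv.congr_of_mem (fun τ hτ => hrep _ (hw τ hτ) x hx) ht).derivWithin
    (uniqueDiffOn_Icc hT t ht)

theorem Mesh.integral_mul_eq_sum_interpolation (hab : a < b)
    {y : ∀ _ : Fin m.N, Fin (k + 1) → ℝ} {p : ∀ _ : Fin m.N, Fin (k + 1) → Polynomial ℝ}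
    (hrep : ∀ j, ∀ v ∈ m.dgSpace k, ∀ x ∈ m.cell j, v x = ∑ i, v (y j i) * (p j i).eval x)
    {f g : ℝ → ℝ} (hf : f ∈ m.dgSpace k) (hg : MemLp g ⊤ volume) :
    ∫ x in a..b, f x * g x
      = ∑ j, ∑ i, f (y j i) * ∫ x in (m.left j)..(m.right j), (p j i).eval x * g x := by
  rw [← m.sum_integral_cell hab.le (intervalIntegrable_of_memLp_top
    (memLp_top_mul (memLp_top_of_mem_dgSpace hab hf) hg) a b)]
  refine Finset.sum_congr rfl fun j _ => ?_
  have hgj := intervalIntegrable_of_memLp_top hg (m.left j) (m.right j)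
  rw [integral_congr_of_eqOn_Ioo (m.left_lt_right j).le
    (g := fun x => ∑ i, f (y j i) * ((p j i).eval x * g x)) fun x hx => by
      simp only [hrep j f hf x hx, Finset.sum_mul, mul_assoc],
    intervalIntegral.integral_finsetSum fun i _ =>
      (hgj.continuousOn_mul (p j i).continuous.continuousOn).const_mul _]
  simp only [intervalIntegral.integral_const_mul]

theorem Mesh.hasWeakTimeDeriv_dt (hab : a < b) (hT : 0 < T)
    (hw : ∀ t ∈ Icc 0 T, (fun x => w x t) ∈ m.dgSpace k)
    (hd : ∀ j, ∀ x ∈ m.cell j, DifferentiableOn ℝ (fun t => w x t) (Icc 0 T)) :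
    HasWeakTimeDeriv a b T w (dt T w) := by
  choose y p hy _ hrep using m.exists_interpolation k
  have hdw : ∀ t ∈ Icc 0 T, (fun x => dt T w x t) ∈ m.dgSpace k := fun t ht =>
    dt_mem_dgSpace hT hw hd ht
  have hderiv : ∀ {g : ℝ → ℝ}, MemLp g ⊤ volume → ∀ t ∈ Icc 0 T, HasDerivWithinAt
      (fun τ => ∫ x in a..b, w x τ * g x) (∫ x in a..b, dt T w x t * g x) (Icc 0 T) t := by
    intro g hg t ht
    rw [integral_mul_eq_sum_interpolation hab hrep (hdw t ht) hg]
    refine HasDerivWithinAt.congr_of_mem (f := fun τ => ∑ j, ∑ i, w (y j i) τ *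
      ∫ x in (m.left j)..(m.right j), (p j i).eval x * g x) ?_
      (fun τ hτ => integral_mul_eq_sum_interpolation hab hrep (hw τ hτ) hg) ht
    exact HasDerivWithinAt.fun_sum fun j _ => HasDerivWithinAt.fun_sum fun i _ =>
      (hasDerivWithinAt_dt (hd j _ (hy j i)) ht).mul_const _
  exact ⟨fun t ht => memLp_top_of_mem_dgSpace hab (hw t ht),
    fun t ht => memLp_top_of_mem_dgSpace hab (hdw t ht),
    fun hg t ht => (hderiv hg t ht).continuousWithinAt,
    fun hg t ht => (hderiv hg t (Ioo_subset_Icc_self ht)).hasDerivAt (Icc_mem_nhds ht.1 ht.2)⟩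

end DGFamilies

section SmoothFamilies

variable {U : ℝ → ℝ → ℝ}

theorem contDiff_slice {n : WithTop ℕ∞}
    (hU : ContDiffOn ℝ n (fun p : ℝ × ℝ => U p.1 p.2) (univ ×ˢ Icc 0 T)) {t : ℝ}
    (ht : t ∈ Icc 0 T) : ContDiff ℝ n fun x => U x t := by
  rw [← contDiffOn_univ]
  exact hU.comp (f := fun x : ℝ => (x, t)) (by fun_prop) fun x _ => ⟨mem_univ _, ht⟩

theorem differentiableOn_time
    (hU : ContDiffOn ℝ 1 (fun p : ℝ × ℝ => U p.1 p.2) (univ ×ˢ Icc 0 T)) (x : ℝ) :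
    DifferentiableOn ℝ (fun t => U x t) (Icc 0 T) :=
  (hU.differentiableOn one_ne_zero).comp (f := fun t : ℝ => (x, t)) (by fun_prop)
    fun _ ht => ⟨mem_univ _, ht⟩

theorem contDiffOn_dt (hT : 0 < T) {n : ℕ}
    (hU : ContDiffOn ℝ (n + 1 : ℕ) (fun p : ℝ × ℝ => U p.1 p.2) (univ ×ˢ Icc 0 T)) :
    ContDiffOn ℝ n (fun p : ℝ × ℝ => dt T U p.1 p.2) (univ ×ˢ Icc 0 T) := by
  have hud : UniqueDiffOn ℝ ((univ : Set ℝ) ×ˢ Icc 0 T) :=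
    uniqueDiffOn_univ.prod (uniqueDiffOn_Icc hT)
  have hfd := hU.fderivWithin hud (m := (n : WithTop ℕ∞)) (by exact_mod_cast le_rfl)
  refine (hfd.clm_apply (contDiffOn_const (c := ((0 : ℝ), (1 : ℝ))))).congr fun p hp => ?_
  have hline : HasDerivWithinAt (fun τ : ℝ => (p.1, τ)) ((0 : ℝ), (1 : ℝ)) (Icc 0 T) p.2 :=
    (hasDerivWithinAt_const _ _ _).prodMk (hasDerivWithinAt_id _ _)
  exact (HasFDerivWithinAt.comp_hasDerivWithinAt (f := fun τ : ℝ => (p.1, τ)) p.2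
    (hU.differentiableOn (by simp) p hp).hasFDerivWithinAt hline
    fun τ hτ => ⟨mem_univ _, hτ⟩).derivWithin (uniqueDiffOn_Icc hT p.2 hp.2)

theorem exists_norm_mul_le (hU : ContinuousOn (fun p : ℝ × ℝ => U p.1 p.2) (univ ×ˢ Icc 0 T))
    (a b : ℝ) (g : ℝ → ℝ) :
    ∃ C, ∀ x ∈ Ioc a b, ∀ t ∈ Icc 0 T, ‖U x t * g x‖ ≤ C * ‖g x‖ := by
  obtain ⟨C, hC⟩ := (isCompact_Icc (a := a) (b := b)).prod (isCompact_Icc (a := (0 : ℝ)) (b := T))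
    |>.exists_bound_of_continuousOn (hU.mono (prod_mono (subset_univ _) le_rfl))
  refine ⟨C, fun x hx t ht => ?_⟩
  rw [norm_mul]
  exact mul_le_mul_of_nonneg_right (hC (x, t) ⟨Ioc_subset_Icc_self hx, ht⟩) (norm_nonneg _)

variable {g : ℝ → ℝ}

theorem continuousOn_integral_mul (hab : a < b)
    (hU : ContinuousOn (fun p : ℝ × ℝ => U p.1 p.2) (univ ×ˢ Icc 0 T))
    (hg : MemLp g ⊤ volume) : ContinuousOn (fun t => ∫ x in a..b, U x t * g x) (Icc 0 T) := by
  obtain ⟨C, hC⟩ := exists_norm_mul_le hU a b g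
  rw [← uIoc_of_le hab.le] at hC
  refine fun t ht => intervalIntegral.continuousWithinAt_of_dominated_interval
    (bound := fun x => C * ‖g x‖) ?_ ?_ ?_ (.of_forall fun x _ => ?_)
  · filter_upwards [self_mem_nhdsWithin] with τ hτ
    exact ((contDiff_slice (contDiffOn_zero.2 hU) hτ).continuous.aestronglyMeasurable.mul
      hg.1).restrict
  · filter_upwards [self_mem_nhdsWithin] with τ hτ using .of_forall fun x hx => hC x hx τ hτ
  · exact (intervalIntegrable_of_memLp_top hg a b).norm.const_mul C
  · exact ((hU.comp (f := fun τ : ℝ => (x, τ)) (by fun_prop)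
      fun τ hτ => ⟨mem_univ _, hτ⟩) t ht).mul continuousWithinAt_const

theorem hasDerivAt_integral_mul (hab : a < b) (hT : 0 < T)
    (hU : ContDiffOn ℝ 1 (fun p : ℝ × ℝ => U p.1 p.2) (univ ×ˢ Icc 0 T))
    (hg : MemLp g ⊤ volume) {t : ℝ} (ht : t ∈ Ioo 0 T) :
    HasDerivAt (fun τ => ∫ x in a..b, U x τ * g x) (∫ x in a..b, dt T U x t * g x) t := by
  have hdt : ContDiffOn ℝ 0 (fun p : ℝ × ℝ => dt T U p.1 p.2) (univ ×ˢ Icc 0 T) :=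
    contDiffOn_dt (n := 0) hT (by simpa only [zero_add, Nat.cast_one] using hU)
  obtain ⟨C, hC⟩ := exists_norm_mul_le hdt.continuousOn a b g
  rw [← uIoc_of_le hab.le] at hC
  have hmem := Ioo_subset_Icc_self ht
  have hgi := intervalIntegrable_of_memLp_top hg a b
  refine (intervalIntegral.hasDerivAt_integral_of_dominated_loc_of_deriv_le
    (F := fun τ x => U x τ * g x) (F' := fun τ x => dt T U x τ * g x)
    (bound := fun x => C * ‖g x‖) (isOpen_Ioo.mem_nhds ht) ?_
    (hgi.continuousOn_mul (contDiff_slice hU hmem).continuous.continuousOn)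
    ((contDiff_slice hdt hmem).continuous.aestronglyMeasurable.mul hg.1).restrict
    (.of_forall fun x hx τ hτ => hC x hx τ (Ioo_subset_Icc_self hτ)) (hgi.norm.const_mul C)
    (.of_forall fun x _ τ hτ => ?_)).2
  · filter_upwards [isOpen_Ioo.mem_nhds ht] with τ hτ
    exact ((contDiff_slice hU
      (Ioo_subset_Icc_self hτ)).continuous.aestronglyMeasurable.mul hg.1).restrict
  · exact ((hasDerivWithinAt_dt (differentiableOn_time hU x)
      (Ioo_subset_Icc_self hτ)).hasDerivAt (Icc_mem_nhds hτ.1 hτ.2)).mul_const _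

theorem hasWeakTimeDeriv_dt_of_contDiffOn (hab : a < b) (hT : 0 < T)
    (hU : ContDiffOn ℝ 1 (fun p : ℝ × ℝ => U p.1 p.2) (univ ×ˢ Icc 0 T))
    (hp : ∀ t ∈ Icc 0 T, Function.Periodic (fun x => U x t) (b - a)) :
    HasWeakTimeDeriv a b T U (dt T U) where
  memLp_top t ht := memLp_top_of_continuous_periodic (sub_pos.2 hab)
    (contDiff_slice hU ht).continuous (hp t ht)
  memLp_top_deriv t ht := memLp_top_of_continuous_periodic (sub_pos.2 hab)
    (contDiff_slice (contDiffOn_dt (n := 0) hT (by simpa only [zero_add, Nat.cast_one] using hU))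
      ht).continuous (dt_periodic hp ht)
  continuousOn hg := continuousOn_integral_mul hab hU.continuousOn hg
  hasDerivAt hg _ ht := hasDerivAt_integral_mul hab hT hU hg ht

end SmoothFamilies

end TimeDerivative

section Gronwall

variable {E : Type*} [NormedAddCommGroup E] [NormedSpace ℝ E] {K ε : ℝ}

theorem continuous_gronwallBound {X : Type*} [TopologicalSpace X] {δ x : X → ℝ}
    (hδ : Continuous δ) (hx : Continuous x) (K ε : ℝ) :
    Continuous fun y => gronwallBound (δ y) K ε (x y) := by
  rcases eq_or_ne K 0 with rfl | hK
  · simp only [gronwallBound_K0]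
    fun_prop
  · simp only [gronwallBound_of_K_ne_0 hK]
    fun_prop

theorem norm_le_gronwallBound_of_hasDerivAt_Ioo {a b : ℝ} {f f' : ℝ → E}
    (hf : ContinuousOn f (Icc a b)) (hf' : ∀ t ∈ Ioo a b, HasDerivAt f (f' t) t)
    (hbound : ∀ t ∈ Ioo a b, ‖f' t‖ ≤ K * ‖f t‖ + ε) {t : ℝ} (ht : t ∈ Icc a b) :
    ‖f t‖ ≤ gronwallBound ‖f a‖ K ε (t - a) := by
  rcases ht.1.eq_or_lt with rfl | hat
  · rw [sub_self, gronwallBound_x0]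
  have hstep : ∀ t₀ ∈ Ioo a t, ‖f t‖ ≤ gronwallBound ‖f t₀‖ K ε (t - t₀) := fun t₀ ht₀ =>
    have hsub : Ico t₀ t ⊆ Ioo a b := fun τ hτ => ⟨ht₀.1.trans_le hτ.1, hτ.2.trans_le ht.2⟩
    norm_le_gronwallBound_of_norm_deriv_right_le (hf.mono (Icc_subset_Icc ht₀.1.le ht.2))
      (fun τ hτ => (hf' τ (hsub hτ)).hasDerivWithinAt) le_rfl (fun τ hτ => hbound τ (hsub hτ))
      t ⟨ht₀.2.le, le_rfl⟩
  have hlim : Tendsto (fun t₀ => gronwallBound ‖f t₀‖ K ε (t - t₀)) (𝓝[Ioo a t] a)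
      (𝓝 (gronwallBound ‖f a‖ K ε (t - a))) :=
    ((continuous_gronwallBound continuous_fst (continuous_const.sub continuous_snd) K ε).tendsto
      (‖f a‖, a)).comp ((((hf a ⟨le_rfl, ht.1.trans ht.2⟩).mono
        fun τ hτ => ⟨hτ.1.le, hτ.2.le.trans ht.2⟩).norm.tendsto).prodMk_nhds nhdsWithin_le_nhds)
  have hne : (𝓝[Ioo a t] a).NeBot := by
    rw [nhdsWithin_Ioo_eq_nhdsGT hat]
    infer_instance
  refine ge_of_tendsto hlim ?_
  filter_upwards [self_mem_nhdsWithin] with τ hτ using hstep τ hτ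

theorem norm_le_of_second_order_bound {T : ℝ} (hK : 1 ≤ K) (hε : 0 ≤ ε) {c d g : ℝ → E}
    (hc : ContinuousOn c (Icc 0 T)) (hd : ContinuousOn d (Icc 0 T))
    (hcd : ∀ t ∈ Ioo 0 T, HasDerivAt c (d t) t) (hdg : ∀ t ∈ Ioo 0 T, HasDerivAt d (g t) t)
    (hc0 : c 0 = 0) (hd0 : d 0 = 0) (hg : ∀ t ∈ Ioo 0 T, ‖g t‖ ≤ K * ‖c t‖ + ε) {t : ℝ}
    (ht : t ∈ Icc 0 T) : ‖(c t, d t)‖ ≤ ε * Real.exp (K * T) := by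
  have hK0 : 0 < K := zero_lt_one.trans_le hK
  have hbound : ∀ τ ∈ Ioo 0 T, ‖(d τ, g τ)‖ ≤ K * ‖(c τ, d τ)‖ + ε := fun τ hτ => by
    have hcτ := mul_le_mul_of_nonneg_left (norm_fst_le (c τ, d τ)) hK0.le
    have hdτ := norm_snd_le (c τ, d τ)
    exact max_le (by nlinarith [norm_nonneg (c τ, d τ)]) ((hg τ hτ).trans (by gcongr))
  have h := norm_le_gronwallBound_of_hasDerivAt_Ioo (hc.prodMk hd)
    (fun τ hτ => (hcd τ hτ).prodMk (hdg τ hτ)) hbound ht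
  simp only [gronwallBound_of_K_ne_0 hK0.ne', hc0, hd0, Prod.mk_zero_zero, norm_zero, zero_mul,
    zero_add, sub_zero] at h
  calc ‖(c t, d t)‖ ≤ ε / K * (Real.exp (K * t) - 1) := h
    _ ≤ ε / K * Real.exp (K * T) := by
        gcongr
        exact (sub_le_self _ zero_le_one).trans (Real.exp_le_exp.2 (by gcongr; exact ht.2))
    _ ≤ ε * Real.exp (K * T) := by
        gcongr
        exact div_le_self hε hK

end Gronwall

/-- A family `e s`, `s ∈ S`, of functions of `x` which, up to null sets in `x`, depends jointly
measurably on `(s, x)`. -/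
def IsMeasurableFamily (S : Set ℝ) (e : ℝ → ℝ → ℝ) : Prop :=
  ∃ F : ℝ → ℝ → ℝ, Measurable (Function.uncurry F) ∧ ∀ s ∈ S, e s =ᵐ[volume] F s

namespace IsMeasurableFamily

variable {S : Set ℝ} {e e' : ℝ → ℝ → ℝ}

theorem const {f : ℝ → ℝ} (hf : AEStronglyMeasurable f volume) :
    IsMeasurableFamily S fun _ => f := by
  obtain ⟨g, hg, hfg⟩ := hf.aemeasurable
  exact ⟨fun _ => g, hg.comp measurable_snd, fun _ _ => hfg⟩

theorem congr (he : IsMeasurableFamily S e) (h : ∀ s ∈ S, e s =ᵐ[volume] e' s) :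
    IsMeasurableFamily S e' := by
  obtain ⟨F, hF, heF⟩ := he
  exact ⟨F, hF, fun s hs => (h s hs).symm.trans (heF s hs)⟩

theorem sub (he : IsMeasurableFamily S e) (he' : IsMeasurableFamily S e') :
    IsMeasurableFamily S fun s x => e s x - e' s x := by
  obtain ⟨F, hF, heF⟩ := he
  obtain ⟨F', hF', heF'⟩ := he'
  exact ⟨fun s x => F s x - F' s x, hF.sub hF', fun s hs => (heF s hs).sub (heF' s hs)⟩

theorem mul (he : IsMeasurableFamily S e) (he' : IsMeasurableFamily S e') :
    IsMeasurableFamily S fun s x => e s x * e' s x := by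
  obtain ⟨F, hF, heF⟩ := he
  obtain ⟨F', hF', heF'⟩ := he'
  exact ⟨fun s x => F s x * F' s x, hF.mul hF', fun s hs => (heF s hs).mul (heF' s hs)⟩

theorem sum {ι : Type*} [Fintype ι] {e : ι → ℝ → ℝ → ℝ} (he : ∀ i, IsMeasurableFamily S (e i)) :
    IsMeasurableFamily S fun s x => ∑ i, e i s x := by
  choose F hF heF using he
  refine ⟨fun s x => ∑ i, F i s x, Finset.measurable_sum _ fun i _ => hF i, fun s hs => ?_⟩
  filter_upwards [eventually_all.2 fun i => heF i s hs] with x hx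
  exact Finset.sum_congr rfl fun i _ => hx i

protected theorem diffQuot (he : IsMeasurableFamily S e) {r : ℝ → ℝ} (hr : Measurable r) :
    IsMeasurableFamily S fun s => diffQuot (r s) (e s) := by
  obtain ⟨F, hF, heF⟩ := he
  have hr1 : Measurable fun p : ℝ × ℝ => r p.1 := hr.comp measurable_fst
  exact ⟨fun s => diffQuot (r s) (F s), (hr1.const_div 1).mul
    ((hF.comp (measurable_fst.prodMk (measurable_snd.add hr1))).sub hF),
    fun s hs => diffQuot_congr_ae (heF s hs) _⟩

theorem exists_measurable_integral (he : IsMeasurableFamily S e) {l r : ℝ} (hlr : l ≤ r) :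
    ∃ G : ℝ → ℝ, Measurable G ∧ ∀ s ∈ S, ∫ x in l..r, e s x = G s := by
  obtain ⟨F, hF, heF⟩ := he
  refine ⟨fun s => ∫ x in Ioc l r, F s x,
    (hF.stronglyMeasurable.integral_prod_right (ν := volume.restrict (Ioc l r))).measurable,
    fun s hs => ?_⟩
  rw [intervalIntegral.integral_of_le hlr]
  exact integral_congr_ae (ae_restrict_of_ae (heF s hs))

theorem integral (he : IsMeasurableFamily S e) {l r : ℝ} (hlr : l ≤ r) :
    IsMeasurableFamily S fun s _ => ∫ x in l..r, e s x := by
  obtain ⟨G, hG, heG⟩ := he.exists_measurable_integral hlr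
  exact ⟨fun s _ => G s, hG.comp measurable_fst, fun s hs => .of_forall fun _ => heG s hs⟩

theorem aestronglyMeasurable_integral (he : IsMeasurableFamily S e) (hS : MeasurableSet S)
    {l r : ℝ} (hlr : l ≤ r) :
    AEStronglyMeasurable (fun s => ∫ x in l..r, e s x) (volume.restrict S) := by
  obtain ⟨G, hG, heG⟩ := he.exists_measurable_integral hlr
  refine hG.aestronglyMeasurable.congr ?_
  filter_upwards [ae_restrict_mem hS] with s hs using (heG s hs).symm

end IsMeasurableFamily

section Kernel

/-- The mass of `|γ|` on `(0, δ)`, which controls the nonlocal operator on `L²`. -/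
noncomputable def kernelMass (δ : ℝ) (γ : ℝ → ℝ) : ℝ := ∫ s in (0 : ℝ)..δ, |γ s|

theorem kernelMass_nonneg {δ : ℝ} (hδ : 0 ≤ δ) (γ : ℝ → ℝ) : 0 ≤ kernelMass δ γ :=
  intervalIntegral.integral_nonneg hδ fun _ _ => abs_nonneg _

variable {δ B : ℝ} {γ f : ℝ → ℝ}

theorem norm_sq_mul_kernel_mul_le {s : ℝ} (hB : s ^ 2 * |f s| ≤ B) :
    ‖s ^ 2 * γ s * f s‖ ≤ B * |γ s| := by
  rw [Real.norm_eq_abs, mul_right_comm, abs_mul, abs_mul, abs_of_nonneg (sq_nonneg s)]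
  gcongr

theorem integrableOn_sq_mul_kernel_mul (hγ : IntegrableOn γ (Ioc 0 δ))
    (hf : AEStronglyMeasurable f (volume.restrict (Ioc 0 δ)))
    (hB : ∀ s ∈ Ioc 0 δ, s ^ 2 * |f s| ≤ B) :
    IntegrableOn (fun s => s ^ 2 * γ s * f s) (Ioc 0 δ) := by
  refine (hγ.norm.const_mul B).mono'
    (((continuous_id.pow 2).aestronglyMeasurable.mul hγ.1).mul hf) ?_
  filter_upwards [ae_restrict_mem measurableSet_Ioc] with s hs
    using norm_sq_mul_kernel_mul_le (hB s hs)

theorem abs_integral_sq_mul_kernel_mul_le (hδ : 0 ≤ δ) (hγ : IntegrableOn γ (Ioc 0 δ))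
    (hB : ∀ s ∈ Ioc 0 δ, s ^ 2 * |f s| ≤ B) :
    |∫ s in (0 : ℝ)..δ, s ^ 2 * γ s * f s| ≤ B * kernelMass δ γ := by
  rw [kernelMass, intervalIntegral.integral_of_le hδ, intervalIntegral.integral_of_le hδ,
    ← integral_const_mul, ← Real.norm_eq_abs]
  refine norm_integral_le_of_norm_le (hγ.norm.const_mul B) ?_
  filter_upwards [ae_restrict_mem measurableSet_Ioc] with s hs
    using norm_sq_mul_kernel_mul_le (hB s hs)

end Kernel

/-- The weak form over `(l, r)` of the nonlocal operator, which applies the backward difference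
quotient of step `s` to the `s`-th member of a family `e` and integrates against `s² γ(s)`. -/
noncomputable def nonlocalForm (δ : ℝ) (γ : ℝ → ℝ) (l r : ℝ) (e : ℝ → ℝ → ℝ) (ρ : ℝ → ℝ) : ℝ :=
  ∫ s in (0 : ℝ)..δ, s ^ 2 * γ s * ∫ x in l..r, diffQuot (-s) (e s) x * ρ x

/-- A family of fluxes `e s`, `0 < s ≤ δ`: like difference quotients of step `s`, its members may
grow at most as `K / s`. -/
structure IsFluxFamily (a b δ K : ℝ) (e : ℝ → ℝ → ℝ) : Prop where
  isMeasurableFamily : IsMeasurableFamily (Ioc 0 δ) e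
  memLp_top : ∀ s ∈ Ioc 0 δ, MemLp (e s) ⊤ volume
  periodic : ∀ s ∈ Ioc 0 δ, Function.Periodic (e s) (b - a)
  mul_l2Norm_le : ∀ s ∈ Ioc 0 δ, s * l2Norm a b (e s) ≤ K

section Flux

variable {a b δ l r : ℝ} {V ρ γ : ℝ → ℝ}

theorem mul_l2Norm_diffQuot_le {s : ℝ} (hs : 0 < s) (hab : a ≤ b) (hV : MemLp V ⊤ volume)
    (hp : Function.Periodic V (b - a)) :
    s * l2Norm a b (diffQuot s V) ≤ 2 * l2Norm a b V := by
  have h := mul_le_mul_of_nonneg_left (l2Norm_diffQuot_le (s := s) hab hV hp) hs.le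
  rwa [abs_of_pos hs, ← mul_assoc, mul_div_cancel₀ _ hs.ne'] at h

theorem isFluxFamily_diffQuot (hab : a ≤ b) (hV : MemLp V ⊤ volume)
    (hp : Function.Periodic V (b - a)) :
    IsFluxFamily a b δ (2 * l2Norm a b V) fun s => diffQuot s V where
  isMeasurableFamily := (IsMeasurableFamily.const hV.1).diffQuot measurable_id
  memLp_top s _ := memLp_top_diffQuot hV s
  periodic s _ := diffQuot_periodic hp s
  mul_l2Norm_le _ hs := mul_l2Norm_diffQuot_le hs.1 hab hV hp

theorem isFluxFamily_of_isL2Projection {m : Mesh a b} {k : ℕ} {Q : ℝ → ℝ → ℝ} (hab : a < b)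
    (hV : MemLp V ⊤ volume) (hp : Function.Periodic V (b - a))
    (hQ : ∀ s ∈ Ioc 0 δ, m.IsL2Projection k (diffQuot s V) (Q s)) :
    IsFluxFamily a b δ (2 * l2Norm a b V) Q := by
  obtain ⟨n, φ, hφ⟩ := m.exists_isOrthonormalBasis hab k
  have hcoeffs : ∀ s ∈ Ioc 0 δ, Mesh.coeffs a b φ (diffQuot s V) = Mesh.coeffs a b φ (Q s) :=
    fun s hs => (hQ s hs).coeffs_eq hab (memLp_top_diffQuot hV s) hφ.mem
  refine ⟨?_, fun s hs => Mesh.memLp_top_of_mem_dgSpace hab (hQ s hs).1,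
    fun s hs => (hQ s hs).1.1, fun s hs => ?_⟩
  · have hφm : ∀ i, IsMeasurableFamily (Ioc 0 δ) fun _ => φ i := fun i =>
      .const (hφ.measurable i).aestronglyMeasurable
    have hdV := (IsMeasurableFamily.const (S := Ioc 0 δ) hV.1).diffQuot measurable_id
    refine (IsMeasurableFamily.sum fun i =>
      ((hdV.mul (hφm i)).integral hab.le).mul (hφm i)).congr fun s hs => ?_
    filter_upwards [hφ.expand _ (hQ s hs).1] with x hx
    rw [hx]
    exact Finset.sum_congr rfl fun i _ =>
      congrArg (· * φ i x) (congrFun (congrArg WithLp.ofLp (hcoeffs s hs)) i)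
  · rw [hφ.l2Norm_eq_norm_coeffs hab (hQ s hs).1, ← hcoeffs s hs]
    exact (mul_le_mul_of_nonneg_left (hφ.norm_coeffs_le_l2Norm hab (memLp_top_diffQuot hV s))
      hs.1.le).trans (mul_l2Norm_diffQuot_le hs.1 hab.le hV hp)

namespace IsFluxFamily

variable {K K' : ℝ} {e e' : ℝ → ℝ → ℝ}

theorem sub (he : IsFluxFamily a b δ K e) (he' : IsFluxFamily a b δ K' e') (hab : a ≤ b) :
    IsFluxFamily a b δ (K + K') fun s x => e s x - e' s x where
  isMeasurableFamily := he.isMeasurableFamily.sub he'.isMeasurableFamily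
  memLp_top s hs := (he.memLp_top s hs).sub (he'.memLp_top s hs)
  periodic s hs := (he.periodic s hs).sub (he'.periodic s hs)
  mul_l2Norm_le s hs := by
    have h := mul_le_mul_of_nonneg_left (l2Norm_sub_le hab
      (memLp_two_Ioc_of_memLp_top (he.memLp_top s hs) a b)
      (memLp_two_Ioc_of_memLp_top (he'.memLp_top s hs) a b)) hs.1.le
    exact h.trans ((mul_add _ _ _).trans_le
      (add_le_add (he.mul_l2Norm_le s hs) (he'.mul_l2Norm_le s hs)))

theorem mono (he : IsFluxFamily a b δ K e) (hK : K ≤ K') : IsFluxFamily a b δ K' e :=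
  { he with mul_l2Norm_le := fun s hs => (he.mul_l2Norm_le s hs).trans hK }

theorem sq_mul_l2Norm_sq_le (he : IsFluxFamily a b δ K e) {s : ℝ} (hs : s ∈ Ioc 0 δ) :
    s ^ 2 * |l2Norm a b (e s) ^ 2| ≤ K ^ 2 := by
  rw [abs_of_nonneg (sq_nonneg _), ← mul_pow]
  exact pow_le_pow_left₀ (mul_nonneg hs.1.le (l2Norm_nonneg _ _ _)) (he.mul_l2Norm_le s hs) 2

theorem integrableOn_l2Norm_sq (he : IsFluxFamily a b δ K e) (hab : a ≤ b)
    (hγ : IntegrableOn γ (Ioc 0 δ)) :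
    IntegrableOn (fun s => s ^ 2 * γ s * l2Norm a b (e s) ^ 2) (Ioc 0 δ) := by
  refine integrableOn_sq_mul_kernel_mul hγ ?_ fun s hs => he.sq_mul_l2Norm_sq_le hs
  simp only [l2Norm_sq hab, pow_two]
  exact (he.isMeasurableFamily.mul he.isMeasurableFamily).aestronglyMeasurable_integral
    measurableSet_Ioc hab

theorem integral_l2Norm_sq_le (he : IsFluxFamily a b δ K e) (hδ : 0 ≤ δ)
    (hγ : IntegrableOn γ (Ioc 0 δ)) :
    ∫ s in (0 : ℝ)..δ, s ^ 2 * γ s * l2Norm a b (e s) ^ 2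
      ≤ K ^ 2 * kernelMass δ γ :=
  (le_abs_self _).trans
    (abs_integral_sq_mul_kernel_mul_le hδ hγ fun _ hs => he.sq_mul_l2Norm_sq_le hs)

theorem sq_mul_abs_integral_le (he : IsFluxFamily a b δ K e) (hρ : MemLp ρ ⊤ volume) (hal : a ≤ l)
    (hlr : l ≤ r) (hrb : r ≤ b) {s : ℝ} (hs : s ∈ Ioc 0 δ) :
    s ^ 2 * |∫ x in l..r, diffQuot (-s) (e s) x * ρ x| ≤ 2 * K * l2Norm l r ρ := by
  have hab : a ≤ b := hal.trans (hlr.trans hrb)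
  have hem := he.memLp_top s hs
  have hdm := memLp_top_diffQuot hem (-s)
  have hd : l2Norm l r (diffQuot (-s) (e s)) ≤ 2 / s * l2Norm a b (e s) := by
    have hsq := intervalIntegrable_of_memLp_top (memLp_top_mul hdm hdm) a b
    simp only [← pow_two] at hsq
    refine (l2Norm_mono_interval hsq hal hlr hrb).trans ?_
    simpa only [abs_neg, abs_of_pos hs.1] using
      l2Norm_diffQuot_le (s := -s) hab hem (he.periodic s hs)
  calc s ^ 2 * |∫ x in l..r, diffQuot (-s) (e s) x * ρ x|
      ≤ s ^ 2 * (2 / s * l2Norm a b (e s) * l2Norm l r ρ) := by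
        gcongr
        exact (abs_integral_mul_le hlr (memLp_two_Ioc_of_memLp_top hdm l r)
          (memLp_two_Ioc_of_memLp_top hρ l r)).trans
          (mul_le_mul_of_nonneg_right hd (l2Norm_nonneg _ _ _))
    _ = 2 * (s * l2Norm a b (e s)) * l2Norm l r ρ := by
        have := hs.1.ne'
        field_simp
    _ ≤ 2 * K * l2Norm l r ρ := by
        gcongr
        · exact l2Norm_nonneg _ _ _
        · exact he.mul_l2Norm_le s hs

theorem integrableOn_nonlocalForm (he : IsFluxFamily a b δ K e) (hγ : IntegrableOn γ (Ioc 0 δ))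
    (hρ : MemLp ρ ⊤ volume) (hal : a ≤ l) (hlr : l ≤ r) (hrb : r ≤ b) :
    IntegrableOn (fun s => s ^ 2 * γ s * ∫ x in l..r, diffQuot (-s) (e s) x * ρ x) (Ioc 0 δ) :=
  integrableOn_sq_mul_kernel_mul hγ
    (((he.isMeasurableFamily.diffQuot measurable_neg).mul
      (.const hρ.1)).aestronglyMeasurable_integral measurableSet_Ioc hlr)
    fun _ hs => he.sq_mul_abs_integral_le hρ hal hlr hrb hs

theorem abs_nonlocalForm_le (he : IsFluxFamily a b δ K e) (hab : a ≤ b) (hδ : 0 ≤ δ)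
    (hγ : IntegrableOn γ (Ioc 0 δ)) (hρ : MemLp ρ ⊤ volume) :
    |nonlocalForm δ γ a b e ρ| ≤ 2 * K * l2Norm a b ρ * kernelMass δ γ :=
  abs_integral_sq_mul_kernel_mul_le hδ hγ fun _ hs =>
    he.sq_mul_abs_integral_le hρ le_rfl hab le_rfl hs

theorem nonlocalForm_sub (he : IsFluxFamily a b δ K e) (he' : IsFluxFamily a b δ K' e')
    (hab : a ≤ b) (hδ : 0 ≤ δ) (hγ : IntegrableOn γ (Ioc 0 δ)) (hρ : MemLp ρ ⊤ volume) :
    nonlocalForm δ γ a b (fun s x => e s x - e' s x) ρ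
      = nonlocalForm δ γ a b e ρ - nonlocalForm δ γ a b e' ρ := by
  simp only [nonlocalForm, intervalIntegral.integral_of_le hδ]
  rw [← integral_sub (he.integrableOn_nonlocalForm hγ hρ le_rfl hab le_rfl)
    (he'.integrableOn_nonlocalForm hγ hρ le_rfl hab le_rfl)]
  refine setIntegral_congr_fun measurableSet_Ioc fun s hs => ?_
  simp only [diffQuot_sub, sub_mul]
  rw [intervalIntegral.integral_sub
    (intervalIntegrable_of_memLp_top
      (memLp_top_mul (memLp_top_diffQuot (he.memLp_top s hs) _) hρ) _ _)
    (intervalIntegrable_of_memLp_top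
      (memLp_top_mul (memLp_top_diffQuot (he'.memLp_top s hs) _) hρ) _ _), mul_sub]

theorem sum_nonlocalForm_cell (he : IsFluxFamily a b δ K e) (m : Mesh a b) (hab : a ≤ b)
    (hδ : 0 ≤ δ) (hγ : IntegrableOn γ (Ioc 0 δ)) (hρ : MemLp ρ ⊤ volume) :
    ∑ j, nonlocalForm δ γ (m.left j) (m.right j) e ρ = nonlocalForm δ γ a b e ρ := by
  simp only [nonlocalForm]
  rw [← intervalIntegral.integral_finsetSum fun j _ =>
    (intervalIntegrable_iff_integrableOn_Ioc_of_le hδ).2 (he.integrableOn_nonlocalForm hγ hρ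
      (m.le_left j) (m.left_lt_right j).le (m.right_le j)),
    intervalIntegral.integral_of_le hδ, intervalIntegral.integral_of_le hδ]
  refine setIntegral_congr_fun measurableSet_Ioc fun s hs => ?_
  rw [← Finset.mul_sum, m.sum_integral_cell hab (intervalIntegrable_of_memLp_top
    (memLp_top_mul (memLp_top_diffQuot (he.memLp_top s hs) _) hρ) a b)]

end IsFluxFamily

theorem sq_mul_diffQuot_neg_diffQuot {s : ℝ} (hs : s ≠ 0) (U : ℝ → ℝ) (x : ℝ) :
    s ^ 2 * diffQuot (-s) (diffQuot s U) x = U (x + s) - 2 * U x + U (x - s) := by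
  rw [diffQuot_neg, diffQuot, diffQuot, sub_add_cancel]
  field_simp
  ring

theorem integral_nonlocal_mul_eq_nonlocalForm (hδ : 0 ≤ δ) (hγ : IntegrableOn γ (Ioc 0 δ))
    {U : ℝ → ℝ} (hU : Continuous U) (hρ : MemLp ρ ⊤ volume) (hlr : l ≤ r) :
    ∫ x in l..r, (∫ s in (0 : ℝ)..δ, s ^ 2 * γ s * diffQuot (-s) (diffQuot s U) x) * ρ x
      = nonlocalForm δ γ l r (fun s => diffQuot s U) ρ := by
  set D : ℝ × ℝ → ℝ := fun p => U (p.2 + p.1) - 2 * U p.2 + U (p.2 - p.1)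
  have hDc : Continuous D := by fun_prop
  obtain ⟨C, hC⟩ := (isCompact_Icc.prod isCompact_Icc).exists_bound_of_continuousOn
    (s := Icc 0 δ ×ˢ Icc l r) hDc.continuousOn
  have hbound : ∀ᵐ p ∂(volume.restrict (Ioc 0 δ)).prod (volume.restrict (Ioc l r)), ‖D p‖ ≤ C := by
    rw [Measure.prod_restrict]
    filter_upwards [ae_restrict_mem (measurableSet_Ioc.prod measurableSet_Ioc)] with p hp
      using hC p ⟨Ioc_subset_Icc_self hp.1, Ioc_subset_Icc_self hp.2⟩
  have hint : Integrable (fun p : ℝ × ℝ => D p * (γ p.1 * ρ p.2))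
      ((volume.restrict (Ioc 0 δ)).prod (volume.restrict (Ioc l r))) :=
    (hγ.mul_prod (intervalIntegrable_of_memLp_top hρ l r).1).bdd_mul hDc.aestronglyMeasurable
      hbound
  have hpt : ∀ s ∈ Ioc 0 δ, ∀ x,
      s ^ 2 * γ s * diffQuot (-s) (diffQuot s U) x = D (s, x) * γ s := fun s hs x => by
    rw [mul_right_comm, sq_mul_diffQuot_neg_diffQuot hs.1.ne']
  calc ∫ x in l..r, (∫ s in (0 : ℝ)..δ, s ^ 2 * γ s * diffQuot (-s) (diffQuot s U) x) * ρ x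
      = ∫ x in Ioc l r, ∫ s in Ioc 0 δ, D (s, x) * (γ s * ρ x) := by
        simp only [intervalIntegral.integral_of_le hδ, intervalIntegral.integral_of_le hlr,
          ← integral_mul_const]
        congr 1 with x
        exact setIntegral_congr_fun measurableSet_Ioc fun s hs => by
          simp only [hpt s hs x, mul_assoc]
    _ = ∫ s in Ioc 0 δ, ∫ x in Ioc l r, D (s, x) * (γ s * ρ x) :=
        (integral_integral_swap hint).symm
    _ = nonlocalForm δ γ l r (fun s => diffQuot s U) ρ := by
        simp only [nonlocalForm, intervalIntegral.integral_of_le hδ,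
          intervalIntegral.integral_of_le hlr, ← integral_const_mul]
        exact setIntegral_congr_fun measurableSet_Ioc fun s hs => by
          simp only [← mul_assoc, hpt s hs]

end Flux

section FixedTime

variable {a b T δ t : ℝ} {γ : ℝ → ℝ} {u : ℝ → ℝ → ℝ} {q : ℝ → ℝ → ℝ → ℝ}

theorem IsExactSolution.flux_eq_diffQuot (hex : IsExactSolution a b T δ γ u q)
    (ht : t ∈ Icc 0 T) {s : ℝ} (hs : s ∈ Ioc 0 δ) :
    (fun x => q x t s) = diffQuot s fun x => u x t :=
  funext fun x => sub_eq_zero.1 (hex.aux t ht s hs x)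

theorem nonlocalForm_congr (hδ : 0 ≤ δ) {e e' : ℝ → ℝ → ℝ} (h : ∀ s ∈ Ioc 0 δ, e s = e' s)
    (l r : ℝ) (ρ : ℝ → ℝ) : nonlocalForm δ γ l r e ρ = nonlocalForm δ γ l r e' ρ := by
  simp only [nonlocalForm, intervalIntegral.integral_of_le hδ]
  exact setIntegral_congr_fun measurableSet_Ioc fun s hs => by simp only [h s hs]

theorem IsFluxFamily.congr {K : ℝ} {e e' : ℝ → ℝ → ℝ} (he : IsFluxFamily a b δ K e)
    (h : ∀ s ∈ Ioc 0 δ, e s = e' s) : IsFluxFamily a b δ K e' where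
  isMeasurableFamily := he.isMeasurableFamily.congr fun s hs => .of_eq (h s hs)
  memLp_top s hs := h s hs ▸ he.memLp_top s hs
  periodic s hs := h s hs ▸ he.periodic s hs
  mul_l2Norm_le s hs := h s hs ▸ he.mul_l2Norm_le s hs

theorem IsExactSolution.isFluxFamily (hex : IsExactSolution a b T δ γ u q) (hab : a < b)
    (hu : Continuous fun x => u x t) (ht : t ∈ Icc 0 T) :
    IsFluxFamily a b δ (2 * l2Norm a b fun x => u x t) fun s x => q x t s :=
  (isFluxFamily_diffQuot hab.le (memLp_top_of_continuous_periodic (sub_pos.2 hab) hu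
    (hex.periodic t ht)) (hex.periodic t ht)).congr fun _ hs => (hex.flux_eq_diffQuot ht hs).symm

theorem IsExactSolution.integral_wave_mul (hex : IsExactSolution a b T δ γ u q) (hab : a ≤ b)
    (hδ : 0 ≤ δ) (hγ : IntegrableOn γ (Ioc 0 δ)) (hu : Continuous fun x => u x t)
    (ht : t ∈ Ioo 0 T) {ρ : ℝ → ℝ} (hρ : MemLp ρ ⊤ volume) :
    ∫ x in a..b, dt T (dt T u) x t * ρ x = 2 * nonlocalForm δ γ a b (fun s x => q x t s) ρ := by
  have hflux : ∀ s ∈ Ioc 0 δ, (fun x => q x t s) = diffQuot s fun x => u x t := fun _ hs =>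
    hex.flux_eq_diffQuot (Ioo_subset_Icc_self ht) hs
  have hwave : ∀ x ∈ Ioo a b, dt T (dt T u) x t
      = 2 * ∫ s in (0 : ℝ)..δ, s ^ 2 * γ s * diffQuot (-s) (diffQuot s fun x => u x t) x :=
    fun x hx => by
      rw [sub_eq_zero.1 (hex.wave t ht x hx), intervalIntegral.integral_of_le hδ,
        intervalIntegral.integral_of_le hδ]
      congr 1
      exact setIntegral_congr_fun measurableSet_Ioc fun s hs => by
        simp only [← hflux s hs, diffQuot_neg]
  rw [nonlocalForm_congr hδ hflux, ← integral_nonlocal_mul_eq_nonlocalForm hδ hγ hu hρ hab,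
    ← intervalIntegral.integral_const_mul]
  exact integral_congr_of_eqOn_Ioo hab fun x hx => by
    rw [hwave x hx, mul_assoc]

variable {m : Mesh a b} {k : ℕ} {uh : ℝ → ℝ → ℝ} {qh : ℝ → ℝ → ℝ → ℝ}

namespace Mesh.IsDGSolution

theorem isL2Projection (hdg : m.IsDGSolution T δ k γ uh qh) (hab : a < b) (ht : t ∈ Icc 0 T)
    {s : ℝ} (hs : s ∈ Ioc 0 δ) :
    m.IsL2Projection k (diffQuot s fun x => uh x t) fun x => qh x t s := by
  refine ⟨hdg.mem_q t ht s hs, fun j p hp => ?_⟩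
  set P : Fin m.N → Polynomial.degreeLT ℝ (k + 1) := fun _ => ⟨p, mem_degreeLT_succ_iff.2 hp⟩
  have hPm := m.memLp_top_piecewise hab P
  have hqm := memLp_top_of_mem_dgSpace hab (hdg.mem_q t ht s hs)
  have hum := memLp_top_diffQuot (memLp_top_of_mem_dgSpace hab (hdg.mem_u t ht)) s
  calc ∫ x in (m.left j)..(m.right j), (diffQuot s (fun x => uh x t) x - qh x t s) * p.eval x
      = ∫ x in (m.left j)..(m.right j), (diffQuot s (fun x => uh x t) x * m.piecewise hab k P x
          - qh x t s * m.piecewise hab k P x) :=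
        integral_congr_of_eqOn_Ioo (m.left_lt_right j).le fun x hx => by
          simp only [m.piecewise_of_mem hab P hx, P, sub_mul]
    _ = m.opH j (fun x => uh x t) (m.piecewise hab k P) s
          - ∫ x in (m.left j)..(m.right j), qh x t s * m.piecewise hab k P x :=
        intervalIntegral.integral_sub
          (intervalIntegrable_of_memLp_top (memLp_top_mul hum hPm) _ _)
          (intervalIntegrable_of_memLp_top (memLp_top_mul hqm hPm) _ _)
    _ = 0 := by
        rw [← neg_sub, hdg.aux t ht s hs j _ (m.piecewise_mem_dgSpace hab P), neg_zero]

theorem isFluxFamily (hdg : m.IsDGSolution T δ k γ uh qh) (hab : a < b) (ht : t ∈ Icc 0 T) :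
    IsFluxFamily a b δ (2 * l2Norm a b fun x => uh x t) fun s x => qh x t s :=
  isFluxFamily_of_isL2Projection hab (memLp_top_of_mem_dgSpace hab (hdg.mem_u t ht))
    (hdg.mem_u t ht).1 fun _ hs => hdg.isL2Projection hab ht hs

theorem integral_wave_mul (hdg : m.IsDGSolution T δ k γ uh qh) (hab : a < b) (hδ : 0 ≤ δ)
    (hγ : IntegrableOn γ (Ioc 0 δ)) (ht : t ∈ Ioo 0 T)
    (hW : MemLp (fun x => dt T (dt T uh) x t) ⊤ volume) {v : ℝ → ℝ} (hv : v ∈ m.dgSpace k) :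
    ∫ x in a..b, dt T (dt T uh) x t * v x = 2 * nonlocalForm δ γ a b (fun s x => qh x t s) v := by
  have hvm := memLp_top_of_mem_dgSpace hab hv
  rw [← m.sum_integral_cell hab.le (intervalIntegrable_of_memLp_top (memLp_top_mul hW hvm) a b),
    ← (hdg.isFluxFamily hab (Ioo_subset_Icc_self ht)).sum_nonlocalForm_cell m hab.le hδ hγ hvm,
    Finset.mul_sum]
  refine Finset.sum_congr rfl fun j _ => ?_
  rw [sub_eq_zero.1 (hdg.wave t ht j v hv)]
  simp only [nonlocalForm, opK, diffQuot_neg]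

variable {ι : Type*} [Fintype ι] [DecidableEq ι] {φ : ι → ℝ → ℝ}

theorem norm_coeffs_acceleration_error_le (hdg : m.IsDGSolution T δ k γ uh qh)
    (hex : IsExactSolution a b T δ γ u q) (hab : a < b) (hδ : 0 < δ)
    (hγ : IntegrableOn γ (Ioc 0 δ)) (hφ : m.IsOrthonormalBasis k φ)
    (hu : Continuous fun x => u x t) (ht : t ∈ Ioo 0 T)
    (hWh : MemLp (fun x => dt T (dt T uh) x t) ⊤ volume)
    (hW : MemLp (fun x => dt T (dt T u) x t) ⊤ volume) {K : ℝ}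
    (hK : IsFluxFamily a b δ K fun s x => qh x t s - q x t s) :
    ‖coeffs a b φ fun x => dt T (dt T uh) x t - dt T (dt T u) x t‖ ≤ 4 * K * kernelMass δ γ := by
  have htI := Ioo_subset_Icc_self ht
  have hK0 : 0 ≤ K := (mul_nonneg hδ.le (l2Norm_nonneg _ _ _)).trans
    (hK.mul_l2Norm_le δ ⟨hδ, le_rfl⟩)
  refine hφ.norm_coeffs_le hab (f := fun x => dt T (dt T uh) x t - dt T (dt T u) x t)
    (hWh.sub hW) (mul_nonneg (mul_nonneg zero_le_four hK0) (kernelMass_nonneg hδ.le γ))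
    fun v hv => ?_
  have hvm := memLp_top_of_mem_dgSpace hab hv
  have herror : ∫ x in a..b, (dt T (dt T uh) x t - dt T (dt T u) x t) * v x
      = 2 * nonlocalForm δ γ a b (fun s x => qh x t s - q x t s) v := by
    simp only [sub_mul]
    rw [intervalIntegral.integral_sub (intervalIntegrable_of_memLp_top (memLp_top_mul hWh hvm) a b)
      (intervalIntegrable_of_memLp_top (memLp_top_mul hW hvm) a b),
      hdg.integral_wave_mul hab hδ.le hγ ht hWh hv,
      hex.integral_wave_mul hab.le hδ.le hγ hu ht hvm,
      (hdg.isFluxFamily hab htI).nonlocalForm_sub (hex.isFluxFamily hab hu htI) hab.le hδ.le hγ hvm,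
      mul_sub]
  rw [herror, abs_mul, abs_two]
  linarith [hK.abs_nonlocalForm_le hab.le hδ.le hγ hvm]

theorem isFluxFamily_error (hdg : m.IsDGSolution T δ k γ uh qh)
    (hex : IsExactSolution a b T δ γ u q) (hab : a < b)
    (hu : ContDiff ℝ (k + 1 : ℕ) fun x => u x t) (ht : t ∈ Icc 0 T) {M : ℝ}
    (hM : ∀ s ∈ Ioc 0 δ, hSeminorm a b (k + 1) (fun x => q x t s) ≤ M) :
    IsFluxFamily a b δ
      (2 * l2Norm a b (fun x => uh x t - u x t) + 2 * δ * (m.size ^ (k + 1) * M))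
      fun s x => qh x t s - q x t s := by
  have hfam := (hdg.isFluxFamily hab ht).sub (hex.isFluxFamily hab hu.continuous ht) hab.le
  refine { hfam with mul_l2Norm_le := fun s hs => ?_ }
  have hup := hex.periodic t ht
  have huhm := memLp_top_of_mem_dgSpace hab (hdg.mem_u t ht)
  have hum := memLp_top_of_continuous_periodic (sub_pos.2 hab) hu.continuous hup
  have hMs := hM s hs
  have hsize := pow_nonneg m.size_nonneg (k + 1)
  have hM0 : 0 ≤ M := (l2Norm_nonneg _ _ _).trans hMs
  have hproj := (hdg.isL2Projection hab ht hs).l2Norm_sub_le hab (memLp_top_diffQuot huhm s)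
    (f := diffQuot s fun x => u x t)
    (contDiff_const.mul ((hu.comp (contDiff_id.add contDiff_const)).sub hu))
    (diffQuot_periodic hup s)
  have hdiff : s * l2Norm a b
      (fun x => diffQuot s (fun x => uh x t) x - diffQuot s (fun x => u x t) x)
      ≤ 2 * l2Norm a b fun x => uh x t - u x t := by
    simp only [← diffQuot_sub]
    exact mul_l2Norm_diffQuot_le hs.1 hab.le (huhm.sub hum) ((hdg.mem_u t ht).1.sub hup)
  rw [← hex.flux_eq_diffQuot ht hs] at hproj hdiff
  calc s * l2Norm a b (fun x => qh x t s - q x t s)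
      ≤ s * (l2Norm a b (fun x => diffQuot s (fun x => uh x t) x - q x t s)
          + 2 * (m.size ^ (k + 1) * M)) :=
        mul_le_mul_of_nonneg_left (hproj.trans (by gcongr)) hs.1.le
    _ ≤ 2 * l2Norm a b (fun x => uh x t - u x t) + 2 * δ * (m.size ^ (k + 1) * M) := by
        rw [mul_add, mul_left_comm s, mul_assoc 2 δ]
        gcongr
        exact hs.2

theorem l2Norm_error_le (hdg : m.IsDGSolution T δ k γ uh qh)
    (hex : IsExactSolution a b T δ γ u q) (hab : a < b) (hδ : 0 < δ)
    (hφ : m.IsOrthonormalBasis k φ) (hu : ContDiff ℝ (k + 2 : ℕ) fun x => u x t)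
    (ht : t ∈ Icc 0 T) {M : ℝ}
    (hM : ∀ s ∈ Ioc 0 δ, hSeminorm a b (k + 1) (fun x => q x t s) ≤ M) :
    l2Norm a b (fun x => uh x t - u x t) ≤ ‖coeffs a b φ fun x => uh x t - u x t‖
      + 2 * (m.size ^ (k + 1) * ((b - a) * M)) := by
  have hsize := pow_nonneg m.size_nonneg (k + 1)
  refine (hφ.l2Norm_sub_le hab (hdg.mem_u t ht)
    (hu.of_le (by exact_mod_cast (k + 1).le_succ)) (hex.periodic t ht)).trans ?_
  gcongr
  exact hSeminorm_le_of_diffQuot hab hδ hu (hex.periodic t ht) fun s hs => by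
    rw [← hex.flux_eq_diffQuot ht hs]
    exact hM s hs

end Mesh.IsDGSolution

end FixedTime

section ErrorEvolution

/-- The constant in the bound for the error projected to `V_h^k`; `G` is the kernel mass. -/
noncomputable def projectedErrorConst (a b T δ G M : ℝ) : ℝ :=
  8 * G * ((2 * (b - a) + δ) * M) * Real.exp ((1 + 8 * G) * T)

variable {a b T δ : ℝ} {γ : ℝ → ℝ} {u : ℝ → ℝ → ℝ} {q : ℝ → ℝ → ℝ → ℝ} {k : ℕ}

theorem hSeminorm_bound_nonneg (hT : 0 < T) (hδ : 0 < δ) {M : ℝ}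
    (hM : ∀ t ∈ Icc 0 T, ∀ s ∈ Ioc 0 δ, hSeminorm a b (k + 1) (fun x => q x t s) ≤ M) : 0 ≤ M :=
  (l2Norm_nonneg _ _ _).trans (hM 0 ⟨le_rfl, hT.le⟩ δ ⟨hδ, le_rfl⟩)

theorem IsExactSolution.hasWeakTimeDeriv (hex : IsExactSolution a b T δ γ u q) (hab : a < b)
    (hT : 0 < T) (hu : ContDiffOn ℝ 1 (fun p : ℝ × ℝ => u p.1 p.2) (univ ×ˢ Icc 0 T)) :
    HasWeakTimeDeriv a b T u (dt T u) :=
  hasWeakTimeDeriv_dt_of_contDiffOn hab hT hu hex.periodic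

theorem IsExactSolution.hasWeakTimeDeriv_dt (hex : IsExactSolution a b T δ γ u q) (hab : a < b)
    (hT : 0 < T) (hu : ContDiffOn ℝ 2 (fun p : ℝ × ℝ => u p.1 p.2) (univ ×ˢ Icc 0 T)) :
    HasWeakTimeDeriv a b T (dt T u) (dt T (dt T u)) :=
  hasWeakTimeDeriv_dt_of_contDiffOn hab hT (contDiffOn_dt (n := 1) hT hu)
    fun _ ht => dt_periodic hex.periodic ht

variable {m : Mesh a b} {uh : ℝ → ℝ → ℝ} {qh : ℝ → ℝ → ℝ → ℝ}

namespace Mesh.IsDGSolution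

theorem differentiableOn (hdg : m.IsDGSolution T δ k γ uh qh) (j : Fin m.N) {x : ℝ}
    (hx : x ∈ m.cell j) : DifferentiableOn ℝ (fun t => uh x t) (Icc 0 T) :=
  (hdg.time_smooth j x hx).differentiableOn two_ne_zero

theorem differentiableOn_dt (hdg : m.IsDGSolution T δ k γ uh qh) (hT : 0 < T) (j : Fin m.N) {x : ℝ}
    (hx : x ∈ m.cell j) : DifferentiableOn ℝ (fun t => dt T uh x t) (Icc 0 T) :=
  ((hdg.time_smooth j x hx).derivWithin (uniqueDiffOn_Icc hT) (m := 1)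
    one_add_one_eq_two.le).differentiableOn one_ne_zero

theorem dt_mem_dgSpace (hdg : m.IsDGSolution T δ k γ uh qh) (hT : 0 < T) {t : ℝ}
    (ht : t ∈ Icc 0 T) : (fun x => dt T uh x t) ∈ m.dgSpace k :=
  Mesh.dt_mem_dgSpace hT hdg.mem_u (fun j _ hx => hdg.differentiableOn j hx) ht

theorem hasWeakTimeDeriv (hdg : m.IsDGSolution T δ k γ uh qh) (hab : a < b) (hT : 0 < T) :
    HasWeakTimeDeriv a b T uh (dt T uh) :=
  Mesh.hasWeakTimeDeriv_dt hab hT hdg.mem_u fun j _ hx => hdg.differentiableOn j hx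

theorem hasWeakTimeDeriv_dt (hdg : m.IsDGSolution T δ k γ uh qh) (hab : a < b) (hT : 0 < T) :
    HasWeakTimeDeriv a b T (dt T uh) (dt T (dt T uh)) :=
  Mesh.hasWeakTimeDeriv_dt hab hT (fun _ ht => hdg.dt_mem_dgSpace hT ht)
    fun j _ hx => hdg.differentiableOn_dt hT j hx

theorem l2Norm_dt_error_eq (hdg : m.IsDGSolution T δ k γ uh qh) (hab : a < b)
    (hu : ∀ x, DifferentiableOn ℝ (fun t => u x t) (Icc 0 T)) {t : ℝ} (ht : t ∈ Icc 0 T) :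
    l2Norm a b (fun x => dt T (fun y τ => uh y τ - u y τ) x t)
      = l2Norm a b fun x => dt T uh x t - dt T u x t := by
  refine congrArg Real.sqrt (intervalIntegral.integral_congr_ae_restrict ?_)
  rw [uIoc_of_le hab.le]
  filter_upwards [m.ae_exists_mem_cell] with x ⟨j, hj⟩
  exact congrArg (· ^ 2) (derivWithin_fun_sub (hdg.differentiableOn j hj t ht) (hu x t ht))

variable {ι : Type*} [Fintype ι] [DecidableEq ι] {φ : ι → ℝ → ℝ} {M : ℝ}

theorem isFluxFamily_error_of_norm_coeffs (hdg : m.IsDGSolution T δ k γ uh qh)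
    (hex : IsExactSolution a b T δ γ u q) (hab : a < b) (hδ : 0 < δ)
    (hφ : m.IsOrthonormalBasis k φ) {t : ℝ} (hu : ContDiff ℝ (k + 2 : ℕ) fun x => u x t)
    (ht : t ∈ Icc 0 T) (hM : ∀ s ∈ Ioc 0 δ, hSeminorm a b (k + 1) (fun x => q x t s) ≤ M) :
    IsFluxFamily a b δ
      (2 * (‖coeffs a b φ fun x => uh x t - u x t‖ + (2 * (b - a) + δ) * M * m.size ^ (k + 1)))
      fun s x => qh x t s - q x t s := by
  refine (hdg.isFluxFamily_error hex hab (hu.of_le (by exact_mod_cast (k + 1).le_succ)) ht hM).mono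
    ?_
  linarith [hdg.l2Norm_error_le hex hab hδ hφ hu ht hM]

theorem norm_coeffs_acceleration_error_le_of_norm_coeffs (hdg : m.IsDGSolution T δ k γ uh qh)
    (hex : IsExactSolution a b T δ γ u q) (hab : a < b) (hT : 0 < T) (hδ : 0 < δ)
    (hγ : IntegrableOn γ (Ioc 0 δ)) (hφ : m.IsOrthonormalBasis k φ)
    (hu : ContDiffOn ℝ (k + 2 : ℕ) (fun p : ℝ × ℝ => u p.1 p.2) (univ ×ˢ Icc 0 T))
    {t : ℝ} (ht : t ∈ Ioo 0 T)
    (hM : ∀ s ∈ Ioc 0 δ, hSeminorm a b (k + 1) (fun x => q x t s) ≤ M) :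
    ‖coeffs a b φ fun x => dt T (dt T uh) x t - dt T (dt T u) x t‖
      ≤ (1 + 8 * kernelMass δ γ) * ‖coeffs a b φ fun x => uh x t - u x t‖
        + 8 * kernelMass δ γ * ((2 * (b - a) + δ) * M) * m.size ^ (k + 1) := by
  have htI := Ioo_subset_Icc_self ht
  have hslice := contDiff_slice hu htI
  have hu2 := hu.of_le (m := 2) (by exact_mod_cast Nat.le_add_left 2 k)
  have h := hdg.norm_coeffs_acceleration_error_le hex hab hδ hγ hφ hslice.continuous ht
    ((hdg.hasWeakTimeDeriv_dt hab hT).memLp_top_deriv t htI)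
    ((hex.hasWeakTimeDeriv_dt hab hT hu2).memLp_top_deriv t htI)
    (hdg.isFluxFamily_error_of_norm_coeffs hex hab hδ hφ hslice htI hM)
  linarith [norm_nonneg (coeffs a b φ fun x => uh x t - u x t)]

theorem norm_coeffs_error_le (hdg : m.IsDGSolution T δ k γ uh qh)
    (hex : IsExactSolution a b T δ γ u q) (hab : a < b) (hT : 0 < T) (hδ : 0 < δ)
    (hγ : IntegrableOn γ (Ioc 0 δ)) (hφ : m.IsOrthonormalBasis k φ)
    (hu : ContDiffOn ℝ (k + 2 : ℕ) (fun p : ℝ × ℝ => u p.1 p.2) (univ ×ˢ Icc 0 T))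
    (hM : ∀ t ∈ Icc 0 T, ∀ s ∈ Ioc 0 δ, hSeminorm a b (k + 1) (fun x => q x t s) ≤ M)
    (hinit : m.HasProjectedInitialData T k u uh) {t : ℝ} (ht : t ∈ Icc 0 T) :
    ‖(coeffs a b φ fun x => uh x t - u x t, coeffs a b φ fun x => dt T uh x t - dt T u x t)‖
      ≤ projectedErrorConst a b T δ (kernelMass δ γ) M * m.size ^ (k + 1) := by
  have hM0 := hSeminorm_bound_nonneg hT hδ hM
  have hG := kernelMass_nonneg hδ.le γ
  have : 0 < b - a := sub_pos.2 hab
  have hsize := m.size_nonneg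
  have h0 : (0 : ℝ) ∈ Icc 0 T := ⟨le_rfl, hT.le⟩
  have hu2 := hu.of_le (m := 2) (by exact_mod_cast Nat.le_add_left 2 k)
  have hw := hex.hasWeakTimeDeriv hab hT (hu2.of_le one_le_two)
  have hvel := (hdg.hasWeakTimeDeriv hab hT).sub hw
  have hacc := (hdg.hasWeakTimeDeriv_dt hab hT).sub (hex.hasWeakTimeDeriv_dt hab hT hu2)
  have hφm := hφ.memLp_top hab
  have hc0 := hinit.1.coeffs_sub_eq_zero hab (hw.memLp_top 0 h0) hφ
  have hd0 := IsL2Projection.coeffs_sub_eq_zero ⟨hdg.dt_mem_dgSpace hT h0, hinit.2⟩ hab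
    (hw.memLp_top_deriv 0 h0) hφ
  refine (norm_le_of_second_order_bound (by linarith) (by positivity)
    (hvel.continuousOn_coeffs hφm) (hacc.continuousOn_coeffs hφm)
    (fun _ => hvel.hasDerivAt_coeffs hφm) (fun _ => hacc.hasDerivAt_coeffs hφm) hc0 hd0
    (fun τ hτ => hdg.norm_coeffs_acceleration_error_le_of_norm_coeffs hex hab hT hδ hγ hφ hu hτ
      (hM τ (Ioo_subset_Icc_self hτ))) ht).trans_eq (mul_right_comm _ _ _)

theorem l2Norm_dt_error_le (hdg : m.IsDGSolution T δ k γ uh qh)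
    (hex : IsExactSolution a b T δ γ u q) (hab : a < b) (hT : 0 < T)
    (hφ : m.IsOrthonormalBasis k φ)
    (hu : ContDiffOn ℝ (k + 2 : ℕ) (fun p : ℝ × ℝ => u p.1 p.2) (univ ×ˢ Icc 0 T)) {t : ℝ}
    (ht : t ∈ Icc 0 T) (hM : hSeminorm a b (k + 1) (fun x => dt T u x t) ≤ M) :
    l2Norm a b (fun x => dt T (fun y τ => uh y τ - u y τ) x t)
      ≤ ‖coeffs a b φ fun x => dt T uh x t - dt T u x t‖ + 2 * (m.size ^ (k + 1) * M) := by
  have hsize := pow_nonneg m.size_nonneg (k + 1)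
  rw [hdg.l2Norm_dt_error_eq hab
    (differentiableOn_time (hu.of_le (by exact_mod_cast Nat.le_add_left 1 (k + 1)))) ht]
  refine (hφ.l2Norm_sub_le hab (hdg.dt_mem_dgSpace hT ht)
    (contDiff_slice (contDiffOn_dt hT hu) ht) (dt_periodic hex.periodic ht)).trans ?_
  gcongr

end Mesh.IsDGSolution

end ErrorEvolution

theorem theorem3p1_general {a b T δ : ℝ} (hab : a < b) (hT : 0 < T) (hδ : 0 < δ) (k : ℕ)
    {γ : ℝ → ℝ} (hγ : IntegrableOn γ (Ioc 0 δ)) (M : ℝ) :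
    ∃ C : ℝ, 0 < C ∧ ∀ (u : ℝ → ℝ → ℝ) (q : ℝ → ℝ → ℝ → ℝ), IsExactSolution a b T δ γ u q →
      ContDiffOn ℝ (k + 2 : ℕ) (fun p : ℝ × ℝ => u p.1 p.2) (univ ×ˢ Icc 0 T) →
      (∀ t ∈ Icc 0 T, hSeminorm a b (k + 1) (fun x => dt T u x t) ≤ M) →
      (∀ t ∈ Icc 0 T, ∀ s ∈ Ioc 0 δ, hSeminorm a b (k + 1) (fun x => q x t s) ≤ M) →
      ∀ (m : Mesh a b) (uh : ℝ → ℝ → ℝ) (qh : ℝ → ℝ → ℝ → ℝ),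
        m.IsDGSolution T δ k γ uh qh → m.HasProjectedInitialData T k u uh → ∀ t ∈ Icc 0 T,
          IntegrableOn (fun s => s ^ 2 * γ s * l2Norm a b (fun x => qh x t s - q x t s) ^ 2)
              (Ioc 0 δ) ∧
            1 / 2 * l2Norm a b (fun x => dt T (fun y τ => uh y τ - u y τ) x t) ^ 2
                + ∫ s in (0 : ℝ)..δ,
                    s ^ 2 * γ s * l2Norm a b (fun x => qh x t s - q x t s) ^ 2
              ≤ C * m.size ^ (2 * k + 2) := by
  set G := kernelMass δ γ
  set E := projectedErrorConst a b T δ G M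
  have hG : 0 ≤ G := kernelMass_nonneg hδ.le γ
  refine ⟨1 + 1 / 2 * (E + 2 * M) ^ 2 + (2 * (E + (2 * (b - a) + δ) * M)) ^ 2 * G, by positivity,
    fun u q hex hu hut hq m uh qh hdg hinit t ht => ?_⟩
  obtain ⟨n, φ, hφ⟩ := m.exists_isOrthonormalBasis hab k
  have hproj := hdg.norm_coeffs_error_le hex hab hT hδ hγ hφ hu hq hinit ht
  have hvel : l2Norm a b (fun x => dt T (fun y τ => uh y τ - u y τ) x t)
      ≤ (E + 2 * M) * m.size ^ (k + 1) := by
    linarith [hdg.l2Norm_dt_error_le hex hab hT hφ hu ht (hut t ht), (norm_snd_le _).trans hproj]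
  have hflux : IsFluxFamily a b δ (2 * (E + (2 * (b - a) + δ) * M) * m.size ^ (k + 1))
      fun s x => qh x t s - q x t s :=
    (hdg.isFluxFamily_error_of_norm_coeffs hex hab hδ hφ (contDiff_slice hu ht) ht (hq t ht)).mono
      (by linarith [(norm_fst_le _).trans hproj])
  refine ⟨hflux.integrableOn_l2Norm_sq hab.le hγ, ?_⟩
  have hvel_sq := pow_le_pow_left₀ (l2Norm_nonneg _ _ _) hvel 2
  have hflux_sq := hflux.integral_l2Norm_sq_le hδ.le hγ
  have hsize : 0 ≤ (m.size ^ (k + 1)) ^ 2 := sq_nonneg _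
  rw [show 2 * k + 2 = (k + 1) * 2 by ring, pow_mul]
  linarith

end NonlocalDG

theorem theorem3p1 (a b T δ ν : ℝ) (hab : a < b) (hT : 0 < T) (hδ : 0 < δ) (hν : 0 < ν)
    (k : ℕ) (γ : ℝ → ℝ) (hγ : NonlocalDG.KernelCondition δ γ)
    (hloc : MeasureTheory.LocallyIntegrable γ MeasureTheory.volume) (M : ℝ) :
    ∃ C : ℝ, 0 < C ∧
      ∀ (u : ℝ → ℝ → ℝ) (q : ℝ → ℝ → ℝ → ℝ),
        NonlocalDG.IsExactSolution a b T δ γ u q →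
        ContDiffOn ℝ ((k + 2 : ℕ) : WithTop ℕ∞) (fun p : ℝ × ℝ => u p.1 p.2)
          (Set.univ ×ˢ Set.Icc 0 T) →
        (∀ t ∈ Set.Icc 0 T,
          NonlocalDG.hSeminorm a b (k + 1) (fun x => NonlocalDG.dt T u x t) ≤ M) →
        (∀ t ∈ Set.Icc 0 T, ∀ s ∈ Set.Ioc 0 δ,
          NonlocalDG.hSeminorm a b (k + 1) (fun x => q x t s) ≤ M) →
        ∀ m : NonlocalDG.Mesh a b, m.IsRegular ν →
        ∀ (uh : ℝ → ℝ → ℝ) (qh : ℝ → ℝ → ℝ → ℝ),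
          m.IsDGSolution T δ k γ uh qh →
          m.HasProjectedInitialData T k u uh →
          ∀ t ∈ Set.Icc 0 T,
            MeasureTheory.IntegrableOn
              (fun s => s ^ 2 * γ s * NonlocalDG.l2Norm a b (fun x => qh x t s - q x t s) ^ 2)
              (Set.Ioc 0 δ) MeasureTheory.volume ∧
            1 / 2 * NonlocalDG.l2Norm a b
                (fun x => NonlocalDG.dt T (fun y τ => uh y τ - u y τ) x t) ^ 2
              + ∫ s in (0 : ℝ)..δ, s ^ 2 * γ s *
                  NonlocalDG.l2Norm a b (fun x => qh x t s - q x t s) ^ 2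
              ≤ C * m.size ^ (2 * k + 2) := by
  obtain ⟨C, hC, h⟩ := NonlocalDG.theorem3p1_general hab hT hδ k
    ((hloc.integrableOn_isCompact isCompact_Icc).mono_set Set.Ioc_subset_Icc_self) M
  exact ⟨C, hC, fun u q hex hu hut hq m _ => h u q hex hu hut hq m⟩
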